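/- Work in the category $\mathbf{Loc}$ of locales (the opposite of the category of frames) with its finite products. For maps $f,g\colon X\to Y$ of locales write $f\sqsubseteq g$ (specialization order) if $f^*U\le g^*U$ for every open $U$ of $Y$. Let $\mathbb I=[-1,1]$ be the locale of Dedekind reals in $[-1,1]$, and let $m\colon\mathbb I\times\mathbb I\to\mathbb I$ be the midpoint map $m(x,y)=\frac{x+y}{2}$. Then $(\mathbb I,m)$ is a midpoint algebra, that is, $m(x,x)=x$, $m(x,y)=m(y,x)$ and $m(m(x,y),m(z,w))=m(m(x,z),m(y,w))$, and it is iterative: for every locale $X$ and all maps $h\colon X\to\mathbb I$, $t\colon X\to X$ there is a unique map $M\colon X\to\mathbb I$ with $$M=m\circ(\mathbb I\times M)\circ\langle h,t\rangle .$$ Moreover, $M$ is obtained as follows. Let $D$ be the set of dyadic rationals in $(-1,1)$. A formal ball is a pair $(q,\delta)$ with $q\in D$ and $\delta$ a positive rational; write $(q,\delta)\subset(r,\varepsilon)$ if $|r-q|+\delta<\varepsilon$. Let $\mathrm{Ball}(D)$ be the ball domain, the locale whose points are the rounded filters of formal balls (with respect to $\subset$), and let $\mathsf r\colon\mathrm{Ball}(D)\to\overleftarrow{[0,\infty)}$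 be the radius map to the locale of upper reals in $[0,\infty)$, where $\mathsf r(F)$ is the infimum of the radii of the balls in $F$. Let $\bot$ be the point of $\mathrm{Ball}(D)$ that consists of the formal balls $(q,\delta)$ with $(0,1)\subset(q,\delta)$, let $B$ be the sublocale of the points $F$ with $\bot\sqsubseteq F$ (that is, $(0,1+\varepsilon)\in F$ for all rational $\varepsilon>0$), and let $i\colon\mathbb I\to B$ be the embedding that sends $x$ to $\{(q,\delta)\mid q-\delta<x<q+\delta\}$. Let $m'\colon\mathbb I\times B\to B$ be the map that sends $(x,F)$ to the set of formal balls $p$ with $\left(\frac{q+r}{2},\frac{\delta+\varepsilon}{2}\right)\subset p$ for some $(q,\delta)\in i(x)$ and $(r,\varepsilon)\in F$. For $h,t$ as above and $f\colon X\to B$ put $T(f)=m'\circ(\mathbb I\times f)\circ\langle h,t\rangle$. Then, in the order $\sqsubseteq$ on the maps $X\to B$, the operator $T$ has a least fixpoint $\widetilde M$; it is the supremum of the iterates $T^n(\bot)$, $n\ge 0$, of the constant map $\bot$; it satisfies $\mathsf r\circ\widetilde M=0$; and it factors as $\widetilde M=i\circ M$, where $M\colon X\to\mathbb I$ is the unique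 solution of the displayed equation. -/

import Mathlib

open CategoryTheory MonoidalCategory CartesianMonoidalCategory

universe u

/-! ### Frames presented by generators and relations -/

/-- The free frame on a set `G` of generators: the lower sets of the free meet-semilattice on `G`
(finite subsets of `G`, ordered by reverse inclusion). -/
abbrev FreeFrame (G : Type u) : Type u := LowerSet (Finset G)ᵒᵈ

namespace FreeFrame

/-- The generators of the free frame. -/
def gen {G : Type u} (g : G) : FreeFrame G := LowerSet.Iic (OrderDual.toDual {g})

variable {G : Type u} {L : Type*} [Order.Frame L]

theorem inf_le_iSup (f : G → L) (J : FreeFrame G) {s : (Finset G)ᵒᵈ} (hs : s ∈ J) :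
    (OrderDual.ofDual s).inf f ≤ ⨆ s ∈ J, (OrderDual.ofDual s).inf f :=
  le_iSup₂ (f := fun (s : (Finset G)ᵒᵈ) (_ : s ∈ J) => (OrderDual.ofDual s).inf f) s hs

/-- The frame homomorphism out of the free frame that extends a function on the generators. -/
def lift (f : G → L) : FrameHom (FreeFrame G) L where
  toFun J := ⨆ s ∈ J, (OrderDual.ofDual s).inf f
  map_inf' J K := by
    classical
    apply le_antisymm
    · refine iSup₂_le fun s hs => ?_
      exact le_inf (inf_le_iSup f J hs.1) (inf_le_iSup f K hs.2)
    · rw [iSup₂_inf_eq]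
      refine iSup₂_le fun s hs => ?_
      rw [inf_iSup₂_eq]
      refine iSup₂_le fun t ht => ?_
      have : (OrderDual.ofDual s).inf f ⊓ (OrderDual.ofDual t).inf f =
          (OrderDual.ofDual (OrderDual.toDual (OrderDual.ofDual s ∪ OrderDual.ofDual t))).inf f := by
        rw [OrderDual.ofDual_toDual, Finset.inf_union]
      rw [this]
      refine inf_le_iSup f (J ⊓ K) ⟨J.lower ?_ hs, K.lower ?_ ht⟩
      · exact Finset.subset_union_left (s₁ := OrderDual.ofDual s)
      · exact Finset.subset_union_right (s₁ := OrderDual.ofDual s)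
  map_top' := by
    apply top_le_iff.1
    exact le_trans (by simp) (inf_le_iSup f ⊤ (s := OrderDual.toDual ∅) trivial)
  map_sSup' S := by
    apply le_antisymm
    · refine iSup₂_le fun s hs => ?_
      obtain ⟨J, hJ, hsJ⟩ := LowerSet.mem_sSup_iff.1 hs
      exact (inf_le_iSup f J hsJ).trans (le_sSup ⟨J, hJ, rfl⟩)
    · refine sSup_le ?_
      rintro _ ⟨J, hJ, rfl⟩
      refine iSup₂_le fun s hs => ?_
      exact inf_le_iSup f (sSup S) (LowerSet.mem_sSup_iff.2 ⟨J, hJ, hs⟩)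

theorem lift_apply (f : G → L) (J : FreeFrame G) :
    lift f J = ⨆ s ∈ J, (OrderDual.ofDual s).inf f := rfl

@[simp]
theorem lift_gen (f : G → L) (g : G) : lift f (gen g) = f g := by
  apply le_antisymm
  · refine iSup₂_le fun s hs => ?_
    have hs' : {g} ⊆ OrderDual.ofDual s := hs
    exact Finset.inf_le (hs' (Finset.mem_singleton_self g))
  · have := inf_le_iSup f (gen g) (s := OrderDual.toDual {g}) (LowerSet.mem_Iic_iff.2 le_rfl)
    simpa [lift_apply] using this

theorem Iic_eq (s : (Finset G)ᵒᵈ) : LowerSet.Iic s = (OrderDual.ofDual s).inf gen := by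
  ext t
  simp only [LowerSet.coe_Iic, Set.mem_Iic]
  change s.ofDual ⊆ t.ofDual ↔ t ∈ (s.ofDual.inf fun g => LowerSet.Iic (OrderDual.toDual {g}))
  have : ∀ J : FreeFrame G, t ∈ J ↔ LowerSet.Iic t ≤ J := fun J => by simp
  rw [this, Finset.le_inf_iff]
  simp only [LowerSet.Iic_le, LowerSet.mem_Iic_iff]
  constructor
  · intro h b hb
    exact Finset.singleton_subset_iff.2 (h hb)
  · intro h b hb
    exact Finset.singleton_subset_iff.1 (h b hb)

theorem eq_iSup (J : FreeFrame G) : J = ⨆ s ∈ J, (OrderDual.ofDual s).inf gen := by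
  simp_rw [← Iic_eq]
  ext t
  simp only [SetLike.mem_coe, LowerSet.mem_iSup_iff, LowerSet.mem_Iic_iff]
  exact ⟨fun h => ⟨t, h, le_rfl⟩, fun ⟨s, hs, hts⟩ => J.lower hts hs⟩

theorem hom_ext {φ ψ : FrameHom (FreeFrame G) L} (h : ∀ g, φ (gen g) = ψ (gen g)) : φ = ψ := by
  ext J
  rw [eq_iSup J]
  simp only [map_iSup, map_finset_inf]
  have : (⇑φ ∘ gen) = (⇑ψ ∘ gen) := funext h
  simp only [this]

end FreeFrame

/-- The frame `Fr⟨G | R⟩` presented by a set `G` of generators and a set `R` of relations `a ≤ b`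
between elements of the free frame on `G`. It is realised as the sublocale of the free frame
that consists of those `j` for which `c ⊓ b ≤ j` implies `c ⊓ a ≤ j`, for all relations `a ≤ b`. -/
def presSublocale {G : Type u} (R : FreeFrame G → FreeFrame G → Prop) :
    Sublocale (FreeFrame G) where
  carrier := {j | ∀ a b, R a b → b ⇨ j ≤ a ⇨ j}
  sInf_mem' s hs a b hab := by
    rw [le_himp_iff]
    refine le_sInf fun j hj => ?_
    rw [← le_himp_iff]
    exact (himp_le_himp_left (sInf_le hj)).trans (hs hj a b hab)
  himp_mem' x j hj a b hab := by
    rw [himp_left_comm, himp_left_comm a]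
    exact himp_le_himp_left (hj a b hab)

/-- The underlying type of the frame presented by generators and relations. -/
abbrev Pres {G : Type u} (R : FreeFrame G → FreeFrame G → Prop) : Type u := presSublocale R

namespace Pres

variable {G : Type u} {R : FreeFrame G → FreeFrame G → Prop} {L : Type*} [Order.Frame L]

/-- The canonical quotient map from the free frame. -/
def quot (R : FreeFrame G → FreeFrame G → Prop) : FrameHom (FreeFrame G) (Pres R) :=
  (presSublocale R).restrict

/-- The generators of a presented frame. -/
def gen (R : FreeFrame G → FreeFrame G → Prop) (g : G) : Pres R := quot R (FreeFrame.gen g)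

@[simp]
theorem quot_gen (g : G) : quot R (FreeFrame.gen g) = gen R g := rfl

theorem gc : GaloisConnection (quot R) Subtype.val := (presSublocale R).giRestrict.gc

/-- The relations hold in the presented frame. -/
theorem quot_le {a b : FreeFrame G} (h : R a b) : quot R a ≤ quot R b := by
  rw [gc.le_iff_le]
  have h1 := (quot R b).2 a b h
  have h2 : b ⇨ (quot R b).val = ⊤ := himp_eq_top_iff.2 (gc.le_u_l b)
  rw [h2, top_le_iff, himp_eq_top_iff] at h1
  exact h1

theorem lift_quot_val (f : G → L) (hf : ∀ a b, R a b → FreeFrame.lift f a ≤ FreeFrame.lift f b)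
    (J : FreeFrame G) : FreeFrame.lift f (quot R J).val = FreeFrame.lift f J := by
  have gc' : GaloisConnection (FreeFrame.lift f) (fun l => sSup {J | FreeFrame.lift f J ≤ l}) :=
    fun J l => ⟨fun h => le_sSup h, fun h => (OrderHomClass.mono (FreeFrame.lift f) h).trans <| by
      rw [map_sSup]; exact sSup_le (by rintro _ ⟨K, hK, rfl⟩; exact hK)⟩
  refine le_antisymm ?_ (OrderHomClass.mono (FreeFrame.lift f) (gc.le_u_l J))
  have hmem : sSup {K | FreeFrame.lift f K ≤ FreeFrame.lift f J} ∈ presSublocale R := by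
    intro a b hab
    rw [le_himp_iff, ← gc'.le_iff_le, map_inf]
    refine (inf_le_inf_left _ (hf a b hab)).trans ?_
    rw [← map_inf, gc'.le_iff_le]
    exact himp_inf_le
  rw [gc'.le_iff_le]
  exact (gc (R := R) J ⟨_, hmem⟩).2 (gc'.le_u_l J)

/-- The universal property of the presented frame: existence. -/
def lift (f : G → L) (hf : ∀ a b, R a b → FreeFrame.lift f a ≤ FreeFrame.lift f b) :
    FrameHom (Pres R) L where
  toFun j := FreeFrame.lift f j.val
  map_inf' a b := map_inf (FreeFrame.lift f) a.val b.val
  map_top' := map_top (FreeFrame.lift f)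
  map_sSup' S := by
    have h1 : sSup S = quot R (sSup (Subtype.val '' S)) := by
      rw [gc.l_sSup, sSup_eq_iSup, iSup_image]
      refine iSup_congr fun i => iSup_congr fun _ => ?_
      exact ((presSublocale R).giRestrict.l_u_eq i).symm
    rw [h1, lift_quot_val f hf, map_sSup, Set.image_image]

theorem lift_quot (f : G → L) (hf : ∀ a b, R a b → FreeFrame.lift f a ≤ FreeFrame.lift f b)
    (J : FreeFrame G) : lift f hf (quot R J) = FreeFrame.lift f J :=
  lift_quot_val f hf J

@[simp]
theorem lift_gen (f : G → L) (hf : ∀ a b, R a b → FreeFrame.lift f a ≤ FreeFrame.lift f b)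
    (g : G) : lift f hf (gen R g) = f g := by
  rw [← quot_gen, lift_quot, FreeFrame.lift_gen]

/-- The universal property of the presented frame: uniqueness. -/
theorem hom_ext {φ ψ : FrameHom (Pres R) L} (h : ∀ g, φ (gen R g) = ψ (gen R g)) : φ = ψ := by
  have : φ.comp (quot R) = ψ.comp (quot R) := FreeFrame.hom_ext h
  ext j
  have h1 := DFunLike.congr_fun this j.val
  have h2 : quot R j.val = j := (presSublocale R).giRestrict.l_u_eq j
  simpa [h2] using h1

end Pres

/-! ### The category of locales: maps, specialization order, finite products -/

namespace Locale

/-- The inverse image homomorphism `f^*` of a map of locales. -/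
def inv {X Y : Locale.{u}} (f : X ⟶ Y) : FrameHom Y X := (Quiver.Hom.unop f).hom

/-- The map of locales with a given inverse image homomorphism. -/
def homMk {X Y : Locale.{u}} (φ : FrameHom Y X) : X ⟶ Y := Quiver.Hom.op (Frm.ofHom φ)

@[simp] theorem inv_homMk {X Y : Locale.{u}} (φ : FrameHom Y X) : inv (homMk φ) = φ := rfl

theorem hom_ext {X Y : Locale.{u}} {f g : X ⟶ Y} (h : inv f = inv g) : f = g :=
  Quiver.Hom.unop_inj (Frm.hom_ext h)

@[simp] theorem inv_comp {X Y Z : Locale.{u}} (f : X ⟶ Y) (g : Y ⟶ Z) :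
    inv (f ≫ g) = (inv f).comp (inv g) := rfl

/-- The specialization order on maps of locales: `f ⊑ g` iff `f^* U ≤ g^* U` for all opens `U`. -/
instance homPartialOrder (X Y : Locale.{u}) : PartialOrder (X ⟶ Y) where
  le f g := ∀ U : Y, inv f U ≤ inv g U
  le_refl f U := le_rfl
  le_trans f g h h₁ h₂ U := (h₁ U).trans (h₂ U)
  le_antisymm f g h₁ h₂ := hom_ext (FrameHom.ext fun U => le_antisymm (h₁ U) (h₂ U))

/-- The relations that present the frame of opens of the product of two locales: the inclusions of
both frames into it are frame homomorphisms. -/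
inductive ProdRel (X Y : Type u) [Order.Frame X] [Order.Frame Y] :
    FreeFrame (X ⊕ Y) → FreeFrame (X ⊕ Y) → Prop
  | left_mono {a b : X} : a ≤ b →
      ProdRel X Y (FreeFrame.gen (.inl a)) (FreeFrame.gen (.inl b))
  | left_top : ProdRel X Y ⊤ (FreeFrame.gen (.inl ⊤))
  | left_inf (a b : X) : ProdRel X Y (FreeFrame.gen (.inl a) ⊓ FreeFrame.gen (.inl b))
      (FreeFrame.gen (.inl (a ⊓ b)))
  | left_sSup (S : Set X) : ProdRel X Y (FreeFrame.gen (.inl (sSup S)))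
      (⨆ a ∈ S, FreeFrame.gen (.inl a))
  | right_mono {a b : Y} : a ≤ b →
      ProdRel X Y (FreeFrame.gen (.inr a)) (FreeFrame.gen (.inr b))
  | right_top : ProdRel X Y ⊤ (FreeFrame.gen (.inr ⊤))
  | right_inf (a b : Y) : ProdRel X Y (FreeFrame.gen (.inr a) ⊓ FreeFrame.gen (.inr b))
      (FreeFrame.gen (.inr (a ⊓ b)))
  | right_sSup (S : Set Y) : ProdRel X Y (FreeFrame.gen (.inr (sSup S)))
      (⨆ a ∈ S, FreeFrame.gen (.inr a))

section Prod

variable (X Y : Type u) [Order.Frame X] [Order.Frame Y]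

/-- The first coprojection into the coproduct of frames. -/
def prodInl : FrameHom X (Pres (ProdRel X Y)) where
  toFun a := Pres.gen (ProdRel X Y) (.inl a)
  map_inf' a b := by
    refine le_antisymm (le_inf (Pres.quot_le (.left_mono inf_le_left))
      (Pres.quot_le (.left_mono inf_le_right))) ?_
    simpa using Pres.quot_le (ProdRel.left_inf (Y := Y) a b)
  map_top' := top_le_iff.1 (by simpa using Pres.quot_le (ProdRel.left_top (X := X) (Y := Y)))
  map_sSup' S := by
    refine le_antisymm ?_ ?_
    · rw [sSup_image]
      simpa using Pres.quot_le (ProdRel.left_sSup (Y := Y) S)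
    · refine sSup_le ?_
      rintro _ ⟨a, ha, rfl⟩
      exact Pres.quot_le (.left_mono (le_sSup ha))

/-- The second coprojection into the coproduct of frames. -/
def prodInr : FrameHom Y (Pres (ProdRel X Y)) where
  toFun a := Pres.gen (ProdRel X Y) (.inr a)
  map_inf' a b := by
    refine le_antisymm (le_inf (Pres.quot_le (.right_mono inf_le_left))
      (Pres.quot_le (.right_mono inf_le_right))) ?_
    simpa using Pres.quot_le (ProdRel.right_inf (X := X) a b)
  map_top' := top_le_iff.1 (by simpa using Pres.quot_le (ProdRel.right_top (X := X) (Y := Y)))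
  map_sSup' S := by
    refine le_antisymm ?_ ?_
    · rw [sSup_image]
      simpa using Pres.quot_le (ProdRel.right_sSup (X := X) S)
    · refine sSup_le ?_
      rintro _ ⟨a, ha, rfl⟩
      exact Pres.quot_le (.right_mono (le_sSup ha))

variable {X Y} {L : Type u} [Order.Frame L]

/-- The copairing of two frame homomorphisms. -/
def prodDesc (φ : FrameHom X L) (ψ : FrameHom Y L) : FrameHom (Pres (ProdRel X Y)) L :=
  Pres.lift (Sum.elim φ ψ) <| by
    rintro _ _ (h | _ | ⟨a, b⟩ | S | h | _ | ⟨a, b⟩ | S)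
    · simpa using OrderHomClass.mono φ h
    · simp
    · simp
    · simp [map_sSup, sSup_image]
    · simpa using OrderHomClass.mono ψ h
    · simp
    · simp
    · simp [map_sSup, sSup_image]

theorem prodDesc_inl (φ : FrameHom X L) (ψ : FrameHom Y L) (a : X) :
    prodDesc φ ψ (prodInl X Y a) = φ a := by
  unfold prodDesc
  exact Pres.lift_gen _ _ _

theorem prodDesc_inr (φ : FrameHom X L) (ψ : FrameHom Y L) (b : Y) :
    prodDesc φ ψ (prodInr X Y b) = ψ b := by
  unfold prodDesc
  exact Pres.lift_gen _ _ _

end Prod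

/-- The product of two locales. -/
def prodObj (X Y : Locale.{u}) : Locale.{u} := Locale.of (Pres (ProdRel X Y))

/-- The first projection. -/
def prodFst (X Y : Locale.{u}) : prodObj X Y ⟶ X := homMk (prodInl X Y)

/-- The second projection. -/
def prodSnd (X Y : Locale.{u}) : prodObj X Y ⟶ Y := homMk (prodInr X Y)

theorem desc_fst {T X Y : Locale.{u}} (f : T ⟶ X) (g : T ⟶ Y) :
    homMk (prodDesc (inv f) (inv g)) ≫ prodFst X Y = f :=
  hom_ext (FrameHom.ext fun _ => prodDesc_inl _ _ _)

theorem desc_snd {T X Y : Locale.{u}} (f : T ⟶ X) (g : T ⟶ Y) :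
    homMk (prodDesc (inv f) (inv g)) ≫ prodSnd X Y = g :=
  hom_ext (FrameHom.ext fun _ => prodDesc_inr _ _ _)

/-- The product cone is a limit. -/
def prodLimitCone (X Y : Locale.{u}) : Limits.LimitCone (Limits.pair X Y) where
  cone := Limits.BinaryFan.mk (prodFst X Y) (prodSnd X Y)
  isLimit := Limits.BinaryFan.IsLimit.mk _
    (fun f g => homMk (prodDesc (inv f) (inv g)))
    desc_fst desc_snd
    (fun f g m h₁ h₂ => hom_ext <| Pres.hom_ext <| by
      rintro (a | a)
      · exact (DFunLike.congr_fun (congrArg inv h₁) a).trans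
          (DFunLike.congr_fun (congrArg inv (desc_fst f g)) a).symm
      · exact (DFunLike.congr_fun (congrArg inv h₂) a).trans
          (DFunLike.congr_fun (congrArg inv (desc_snd f g)) a).symm)

/-- The terminal locale: its frame of opens is the initial frame. -/
def one : Locale.{u} := Locale.of (FreeFrame PEmpty.{u + 1})

/-- The terminal locale is terminal. -/
def oneLimitCone : Limits.LimitCone (Functor.empty.{0} Locale.{u}) where
  cone := Limits.asEmptyCone one
  isLimit := Limits.IsTerminal.ofUniqueHom
    (fun X => homMk (FreeFrame.lift (L := X) PEmpty.elim))
    (fun _ _ => hom_ext (FreeFrame.hom_ext fun g => g.elim))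

/-- The category of locales with its finite products. -/
instance : CartesianMonoidalCategory Locale.{u} :=
  .ofChosenFiniteProducts oneLimitCone prodLimitCone

end Locale

/-! ### Midpoint algebras -/

section Midpoint

variable {C : Type*} [Category C] [CartesianMonoidalCategory C]

/-- A midpoint algebra in a category with finite products. The three equations are imposed on all
generalized elements. -/
structure IsMidpointAlgebra {A : C} (m : A ⊗ A ⟶ A) : Prop where
  idem : ∀ {X : C} (x : X ⟶ A), lift x x ≫ m = x
  comm : ∀ {X : C} (x y : X ⟶ A), lift x y ≫ m = lift y x ≫ m
  medial : ∀ {X : C} (x y z w : X ⟶ A),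
    lift (lift x y ≫ m) (lift z w ≫ m) ≫ m = lift (lift x z ≫ m) (lift y w ≫ m) ≫ m

/-- The midpoint algebra `(A, m)` is iterative: for all `h : X ⟶ A` and `t : X ⟶ X` there is a
unique `M : X ⟶ A` with `M = m ∘ (A × M) ∘ ⟨h, t⟩`. -/
def IsIterative {A : C} (m : A ⊗ A ⟶ A) : Prop :=
  ∀ (X : C) (h : X ⟶ A) (t : X ⟶ X), ∃! M : X ⟶ A, M = lift h t ≫ (A ◁ M) ≫ m

end Midpoint

/-! ### The locale `[-1, 1]` of Dedekind reals and its midpoint map -/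

theorem Order.Frame.le_of_cover {L : Type*} [Order.Frame L] {ι : Sort*} {u : ι → L}
    (hu : ⊤ ≤ ⨆ i, u i) {a b : L} (h : ∀ i, u i ⊓ a ≤ b) : a ≤ b := by
  have : a = (⨆ i, u i) ⊓ a := by rw [top_le_iff.1 hu, top_inf_eq]
  rw [this, iSup_inf_eq]
  exact iSup_le h

/-- A Dedekind section of the interval `[-1, 1]` in a frame `L`, that is, a generalized point `x` of
the locale of Dedekind reals in `[-1, 1]`: `lower q` and `upper q` are the truth values of `q < x`
and of `x < q`. -/
structure DedekindSection (L : Type*) [Order.Frame L] where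
  lower : ℚ → L
  upper : ℚ → L
  lower_mono : ∀ {q r : ℚ}, q < r → lower r ≤ lower q
  lower_round : ∀ q : ℚ, lower q ≤ ⨆ (r : ℚ) (_ : q < r), lower r
  lower_inh : ⊤ ≤ ⨆ q : ℚ, lower q
  upper_mono : ∀ {q r : ℚ}, q < r → upper q ≤ upper r
  upper_round : ∀ r : ℚ, upper r ≤ ⨆ (q : ℚ) (_ : q < r), upper q
  upper_inh : ⊤ ≤ ⨆ q : ℚ, upper q
  disj : ∀ q : ℚ, lower q ⊓ upper q ≤ ⊥
  located : ∀ {q r : ℚ}, q < r → ⊤ ≤ lower q ⊔ upper r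
  lower_one : lower 1 ≤ ⊥
  upper_neg_one : upper (-1) ≤ ⊥

/-- The generators of the frame of opens of `[-1, 1]`: `above q` stands for the open `(q, 1]`
and `below q` for the open `[-1, q)`. -/
inductive IntervalGen : Type u
  | above (q : ℚ)
  | below (q : ℚ)

/-- The generator `(q, 1]` in the free frame. -/
abbrev above (q : ℚ) : FreeFrame IntervalGen.{u} := FreeFrame.gen (.above q)

/-- The generator `[-1, q)` in the free frame. -/
abbrev below (q : ℚ) : FreeFrame IntervalGen.{u} := FreeFrame.gen (.below q)

/-- The relations that present the frame of opens of `[-1, 1]`: the axioms of Dedekind sections,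
with `1 < x` and `x < -1` excluded. -/
inductive IntervalRel : FreeFrame IntervalGen.{u} → FreeFrame IntervalGen.{u} → Prop
  | lower_mono {q r : ℚ} : q < r → IntervalRel (above r) (above q)
  | lower_round (q : ℚ) : IntervalRel (above q) (⨆ (r : ℚ) (_ : q < r), above r)
  | lower_inh : IntervalRel ⊤ (⨆ q : ℚ, above q)
  | upper_mono {q r : ℚ} : q < r → IntervalRel (below q) (below r)
  | upper_round (r : ℚ) : IntervalRel (below r) (⨆ (q : ℚ) (_ : q < r), below q)
  | upper_inh : IntervalRel ⊤ (⨆ q : ℚ, below q)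
  | disj (q : ℚ) : IntervalRel (above q ⊓ below q) ⊥
  | located {q r : ℚ} : q < r → IntervalRel ⊤ (above q ⊔ below r)
  | lower_one : IntervalRel (above 1) ⊥
  | upper_neg_one : IntervalRel (below (-1)) ⊥

/-- The locale `[-1, 1]` of Dedekind reals. -/
def Locale.interval : Locale.{u} := Locale.of (Pres IntervalRel.{u})

namespace DedekindSection

variable {L : Type*} [Order.Frame L]

/-- The frame homomorphism, from the opens of `[-1, 1]`, that a Dedekind section determines. -/
def toHom (x : DedekindSection L) : FrameHom (Pres IntervalRel.{u}) L :=
  Pres.lift (fun | .above q => x.lower q | .below q => x.upper q) <| by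
    rintro _ _ (h | q | _ | h | q | _ | q | h | _ | _)
    · simpa using x.lower_mono h
    · simpa [map_iSup] using x.lower_round q
    · simpa [map_iSup] using x.lower_inh
    · simpa using x.upper_mono h
    · simpa [map_iSup] using x.upper_round q
    · simpa [map_iSup] using x.upper_inh
    · simpa using x.disj q
    · simpa using x.located h
    · simpa using x.lower_one
    · simpa using x.upper_neg_one

/-- The Dedekind section that a frame homomorphism from the opens of `[-1, 1]` determines. -/
def ofHom (φ : FrameHom (Pres IntervalRel.{u}) L) : DedekindSection L where
  lower q := φ (Pres.gen _ (.above q))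
  upper q := φ (Pres.gen _ (.below q))
  lower_mono h := OrderHomClass.mono φ (Pres.quot_le (.lower_mono h))
  lower_round q := by
    simpa [map_iSup] using OrderHomClass.mono φ (Pres.quot_le (.lower_round q))
  lower_inh := by simpa [map_iSup] using OrderHomClass.mono φ (Pres.quot_le .lower_inh)
  upper_mono h := OrderHomClass.mono φ (Pres.quot_le (.upper_mono h))
  upper_round q := by
    simpa [map_iSup] using OrderHomClass.mono φ (Pres.quot_le (.upper_round q))
  upper_inh := by simpa [map_iSup] using OrderHomClass.mono φ (Pres.quot_le .upper_inh)
  disj q := by simpa using OrderHomClass.mono φ (Pres.quot_le (.disj q))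
  located h := by simpa using OrderHomClass.mono φ (Pres.quot_le (.located h))
  lower_one := by simpa using OrderHomClass.mono φ (Pres.quot_le .lower_one)
  upper_neg_one := by simpa using OrderHomClass.mono φ (Pres.quot_le .upper_neg_one)

variable (x y : DedekindSection L)

theorem lower_anti {q r : ℚ} (h : q ≤ r) : x.lower r ≤ x.lower q := by
  rcases h.eq_or_lt with rfl | h
  exacts [le_rfl, x.lower_mono h]

theorem upper_monotone {q r : ℚ} (h : q ≤ r) : x.upper q ≤ x.upper r := by
  rcases h.eq_or_lt with rfl | h
  exacts [le_rfl, x.upper_mono h]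

theorem lower_inf_upper {q r : ℚ} (h : r ≤ q) : x.lower q ⊓ x.upper r = ⊥ :=
  le_bot_iff.1 ((inf_le_inf_left _ (x.upper_monotone h)).trans (x.disj q))

theorem lower_eq_bot {q : ℚ} (h : 1 ≤ q) : x.lower q = ⊥ :=
  le_bot_iff.1 ((x.lower_anti h).trans x.lower_one)

theorem upper_eq_bot {q : ℚ} (h : q ≤ -1) : x.upper q = ⊥ :=
  le_bot_iff.1 ((x.upper_monotone h).trans x.upper_neg_one)

theorem lower_eq_top {q : ℚ} (h : q < -1) : x.lower q = ⊤ := by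
  have := x.located h
  rwa [x.upper_eq_bot le_rfl, sup_bot_eq, top_le_iff] at this

theorem upper_eq_top {q : ℚ} (h : 1 < q) : x.upper q = ⊤ := by
  have := x.located h
  rwa [x.lower_eq_bot le_rfl, bot_sup_eq, top_le_iff] at this

theorem approx_aux (n : ℕ) : ⊤ ≤ ⨆ a : ℚ, x.lower a ⊓ x.upper (a + 4 * (2 / 3) ^ n) := by
  induction n with
  | zero =>
    refine le_iSup_of_le (-2) ?_
    rw [x.lower_eq_top (by norm_num), x.upper_eq_top (by norm_num), inf_top_eq]
  | succ n ih =>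
    refine Order.Frame.le_of_cover ih fun a => ?_
    rw [inf_top_eq]
    set w : ℚ := 4 * (2 / 3) ^ n with hw
    have hw0 : 0 < w := by positivity
    have hw' : 4 * (2 / 3 : ℚ) ^ (n + 1) = 2 / 3 * w := by rw [hw, pow_succ]; ring
    rw [hw']
    have hl := x.located (show a + w / 3 < a + 2 / 3 * w by linarith)
    rw [← inf_top_eq (x.lower a ⊓ x.upper (a + w)), ← top_le_iff.1 hl, inf_sup_left]
    refine sup_le ?_ ?_
    · refine le_iSup_of_le (a + w / 3) (le_inf inf_le_right ?_)
      exact (inf_le_left.trans inf_le_right).trans (x.upper_monotone (by linarith))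
    · exact le_iSup_of_le a (le_inf (inf_le_left.trans inf_le_left) inf_le_right)

/-- A Dedekind section has arbitrarily good rational approximations. -/
theorem approx {ε : ℚ} (hε : 0 < ε) : ⊤ ≤ ⨆ a : ℚ, x.lower a ⊓ x.upper (a + ε) := by
  obtain ⟨n, hn⟩ := exists_pow_lt_of_lt_one (show 0 < ε / 4 by positivity)
    (show (2 / 3 : ℚ) < 1 by norm_num)
  refine (x.approx_aux n).trans (iSup_mono fun a => inf_le_inf_left _ (x.upper_monotone ?_))
  linarith

/-- The midpoint `(x + y) / 2` of two Dedekind sections. -/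
def midpoint : DedekindSection L where
  lower q := ⨆ (a : ℚ) (b : ℚ) (_ : q < (a + b) / 2), x.lower a ⊓ y.lower b
  upper q := ⨆ (a : ℚ) (b : ℚ) (_ : (a + b) / 2 < q), x.upper a ⊓ y.upper b
  lower_mono h := iSup₂_mono fun a b => iSup_mono' fun h' => ⟨h.trans h', le_rfl⟩
  lower_round q := by
    refine iSup₂_le fun a b => iSup_le fun h => ?_
    obtain ⟨r, h₁, h₂⟩ := exists_between h
    exact le_iSup₂_of_le r h₁ (le_iSup₂_of_le a b (le_iSup_of_le h₂ le_rfl))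
  lower_inh := by
    refine Order.Frame.le_of_cover x.lower_inh fun a => ?_
    rw [inf_comm]
    have := y.lower_inh
    rw [top_le_iff] at this
    rw [top_inf_eq, ← inf_top_eq (x.lower a), ← this, inf_iSup_eq]
    refine iSup_le fun b => ?_
    exact le_iSup_of_le ((a + b) / 2 - 1) (le_iSup₂_of_le a b (le_iSup_of_le (by linarith) le_rfl))
  upper_mono h := iSup₂_mono fun a b => iSup_mono' fun h' => ⟨h'.trans h, le_rfl⟩
  upper_round q := by
    refine iSup₂_le fun a b => iSup_le fun h => ?_
    obtain ⟨r, h₁, h₂⟩ := exists_between h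
    exact le_iSup₂_of_le r h₂ (le_iSup₂_of_le a b (le_iSup_of_le h₁ le_rfl))
  upper_inh := by
    refine Order.Frame.le_of_cover x.upper_inh fun a => ?_
    rw [inf_comm]
    have := y.upper_inh
    rw [top_le_iff] at this
    rw [top_inf_eq, ← inf_top_eq (x.upper a), ← this, inf_iSup_eq]
    refine iSup_le fun b => ?_
    exact le_iSup_of_le ((a + b) / 2 + 1) (le_iSup₂_of_le a b (le_iSup_of_le (by linarith) le_rfl))
  disj q := by
    simp only [iSup_inf_eq, inf_iSup_eq]
    refine iSup₂_le fun c d => iSup_le fun h' => iSup₂_le fun a b => iSup_le fun h => ?_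
    rcases le_total a c with hac | hac <;> rcases le_total b d with hbd | hbd
    · linarith
    all_goals first
      | exact le_trans (le_inf (inf_le_left.trans inf_le_left) (inf_le_right.trans inf_le_left))
          (x.lower_inf_upper (by assumption)).le
      | exact le_trans (le_inf (inf_le_left.trans inf_le_right) (inf_le_right.trans inf_le_right))
          (y.lower_inf_upper (by assumption)).le
  located {q r} h := by
    have hε : 0 < (r - q) / 2 := by linarith
    refine Order.Frame.le_of_cover (x.approx hε) fun a => ?_
    refine Order.Frame.le_of_cover (y.approx hε) fun b => ?_
    rw [inf_top_eq]
    rcases lt_or_ge q ((a + b) / 2) with hq | hq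
    · refine le_sup_of_le_left (le_iSup₂_of_le a b (le_iSup_of_le hq ?_))
      exact le_inf (inf_le_right.trans inf_le_left) (inf_le_left.trans inf_le_left)
    · refine le_sup_of_le_right (le_iSup₂_of_le (a + (r - q) / 2) (b + (r - q) / 2)
        (le_iSup_of_le (by linarith) ?_))
      exact le_inf (inf_le_right.trans inf_le_right) (inf_le_left.trans inf_le_right)
  lower_one := by
    refine iSup₂_le fun a b => iSup_le fun h => ?_
    rcases le_total 1 a with ha | ha
    · rw [x.lower_eq_bot ha, bot_inf_eq]
    · rw [y.lower_eq_bot (by linarith), inf_bot_eq]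
  upper_neg_one := by
    refine iSup₂_le fun a b => iSup_le fun h => ?_
    rcases le_total a (-1) with ha | ha
    · rw [x.upper_eq_bot ha, bot_inf_eq]
    · rw [y.upper_eq_bot (by linarith), inf_bot_eq]

end DedekindSection

/-- The midpoint map `m : [-1, 1] × [-1, 1] ⟶ [-1, 1]`, `m (x, y) = (x + y) / 2`. -/
def Locale.midpoint : (interval.{u} ⊗ interval.{u}) ⟶ interval.{u} :=
  homMk (((DedekindSection.ofHom (inv (fst interval interval))).midpoint
    (DedekindSection.ofHom (inv (snd interval interval)))).toHom)

/-! ### The ball domain of the dyadic rationals in `(-1, 1)` -/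

/-- The set `D` of dyadic rationals in `(-1, 1)`. -/
def DyadicUnit : Type := {q : ℚ // -1 < q ∧ q < 1 ∧ ∃ (k : ℤ) (n : ℕ), q = k / 2 ^ n}

/-- A formal open ball: a centre in `D` and a positive rational radius. -/
structure FormalBall : Type where
  centre : DyadicUnit
  radius : ℚ
  radius_pos : 0 < radius

namespace FormalBall

/-- The refinement order: `(x, δ) ⊂ (y, ε)` iff `d(y, x) + δ < ε`. -/
def Refines (b c : FormalBall) : Prop := |c.centre.1 - b.centre.1| + b.radius < c.radius

theorem Refines.trans {b c d : FormalBall} (h₁ : b.Refines c) (h₂ : c.Refines d) :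
    b.Refines d := by
  unfold Refines at *
  have := abs_sub_le d.centre.1 c.centre.1 b.centre.1
  linarith

/-- The formal ball with centre `0`. -/
def zero (δ : ℚ) (hδ : 0 < δ) : FormalBall := ⟨⟨0, by norm_num, by norm_num, 0, 0, by simp⟩, δ, hδ⟩

/-- The midpoint of two formal balls: the midpoint of the centres and that of the radii. -/
def midpoint (b c : FormalBall) : FormalBall where
  centre := ⟨(b.centre.1 + c.centre.1) / 2, by
    obtain ⟨⟨q, hq₁, hq₂, k, n, hq⟩, -, -⟩ := b
    obtain ⟨⟨r, hr₁, hr₂, l, m, hr⟩, -, -⟩ := c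
    refine ⟨by dsimp only; linarith, by dsimp only; linarith, k * 2 ^ m + l * 2 ^ n, n + m + 1, ?_⟩
    dsimp only
    subst hq hr
    push_cast
    field_simp
    ring⟩
  radius := (b.radius + c.radius) / 2
  radius_pos := by
    have := b.radius_pos
    have := c.radius_pos
    positivity

theorem Refines.midpoint {b b' c c' : FormalBall} (h₁ : b'.Refines b) (h₂ : c'.Refines c) :
    (b'.midpoint c').Refines (b.midpoint c) := by
  unfold Refines FormalBall.midpoint at *
  dsimp only
  rw [show (b.centre.1 + c.centre.1) / 2 - (b'.centre.1 + c'.centre.1) / 2 =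
    ((b.centre.1 - b'.centre.1) + (c.centre.1 - c'.centre.1)) / 2 by ring, abs_div, abs_two]
  have := abs_add_le (b.centre.1 - b'.centre.1) (c.centre.1 - c'.centre.1)
  linarith

end FormalBall

/-- A rounded filter of formal balls in a frame `L`, that is, a generalized point `F` of the ball
domain of `D`: `ball b` is the truth value of `b ∈ F`. -/
structure BallFilter (L : Type*) [Order.Frame L] where
  ball : FormalBall → L
  mono : ∀ {b c : FormalBall}, b.Refines c → ball b ≤ ball c
  inh : ⊤ ≤ ⨆ b, ball b
  filter : ∀ b c : FormalBall, ball b ⊓ ball c ≤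
    ⨆ (d : FormalBall) (_ : d.Refines b) (_ : d.Refines c), ball d

/-- A rounded filter of formal balls that lies above the filter `⊥` generated by the ball with
centre `0` and radius `1`. -/
structure BallFilterAboveBot (L : Type*) [Order.Frame L] extends BallFilter L where
  above_bot : ∀ (ε : ℚ) (hε : 0 < ε), ⊤ ≤ ball (.zero (1 + ε) (by positivity))

/-- The generator of the frame of opens of the ball domain that belongs to a formal ball. -/
abbrev ballGen (b : FormalBall) : FreeFrame (ULift.{u} FormalBall) := FreeFrame.gen (.up b)

/-- The relations that present the frame of opens of the ball domain of `D`, the points of which are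
the rounded filters of formal balls. -/
inductive BallRel : FreeFrame (ULift.{u} FormalBall) → FreeFrame (ULift.{u} FormalBall) → Prop
  | mono {b c : FormalBall} : b.Refines c → BallRel (ballGen b) (ballGen c)
  | inh : BallRel ⊤ (⨆ b, ballGen b)
  | filter (b c : FormalBall) : BallRel (ballGen b ⊓ ballGen c)
      (⨆ (d : FormalBall) (_ : d.Refines b) (_ : d.Refines c), ballGen d)

/-- The relations that present the up closure of `⊥` in the ball domain of `D`. -/
inductive BallRelAboveBot :
    FreeFrame (ULift.{u} FormalBall) → FreeFrame (ULift.{u} FormalBall) → Prop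
  | of {a b} : BallRel a b → BallRelAboveBot a b
  | above_bot (ε : ℚ) (hε : 0 < ε) : BallRelAboveBot ⊤ (ballGen (.zero (1 + ε) (by positivity)))

/-- The ball domain of `D`, as a locale. -/
def Locale.ballDomain : Locale.{u} := Locale.of (Pres BallRel.{u})

/-- The sublocale `B` of the ball domain: the up closure of the point `⊥` with centre `0` and
radius `1`. -/
def Locale.ballDomainAboveBot : Locale.{u} := Locale.of (Pres BallRelAboveBot.{u})

namespace BallFilter

variable {L : Type*} [Order.Frame L]

/-- The frame homomorphism that a rounded filter determines. -/
def toHom (F : BallFilter L) : FrameHom (Pres BallRel.{u}) L :=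
  Pres.lift (fun b => F.ball b.down) <| by
    rintro _ _ (h | _ | ⟨b, c⟩)
    · simpa using F.mono h
    · simpa [map_iSup] using F.inh
    · simpa [map_iSup] using F.filter b c

/-- The rounded filter that a frame homomorphism determines. -/
def ofHom (φ : FrameHom (Pres BallRel.{u}) L) : BallFilter L where
  ball b := φ (Pres.gen _ (.up b))
  mono h := OrderHomClass.mono φ (Pres.quot_le (.mono h))
  inh := by simpa [map_iSup] using OrderHomClass.mono φ (Pres.quot_le .inh)
  filter b c := by simpa [map_iSup] using OrderHomClass.mono φ (Pres.quot_le (.filter b c))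

/-- Rounded filters are rounded. -/
theorem round (F : BallFilter L) (b : FormalBall) :
    F.ball b ≤ ⨆ (d : FormalBall) (_ : d.Refines b), F.ball d := by
  refine (le_inf le_rfl le_rfl).trans ((F.filter b b).trans ?_)
  exact iSup₂_mono fun d hd => iSup_le fun _ => le_rfl

end BallFilter

namespace BallFilterAboveBot

variable {L : Type*} [Order.Frame L]

/-- The frame homomorphism that a rounded filter above `⊥` determines. -/
def toHom (F : BallFilterAboveBot L) : FrameHom (Pres BallRelAboveBot.{u}) L :=
  Pres.lift (fun b => F.ball b.down) <| by
    rintro _ _ (⟨h | _ | ⟨b, c⟩⟩ | ⟨ε, hε⟩)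
    · simpa using F.mono ‹_›
    · simpa [map_iSup] using F.inh
    · simpa [map_iSup] using F.filter b c
    · simpa using F.above_bot ε hε

/-- The rounded filter above `⊥` that a frame homomorphism determines. -/
def ofHom (φ : FrameHom (Pres BallRelAboveBot.{u}) L) : BallFilterAboveBot L where
  ball b := φ (Pres.gen _ (.up b))
  mono h := OrderHomClass.mono φ (Pres.quot_le (.of (.mono h)))
  inh := by simpa [map_iSup] using OrderHomClass.mono φ (Pres.quot_le (.of .inh))
  filter b c := by
    simpa [map_iSup] using OrderHomClass.mono φ (Pres.quot_le (.of (.filter b c)))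
  above_bot ε hε := by simpa using OrderHomClass.mono φ (Pres.quot_le (.above_bot ε hε))

/-- The rounded filter `⊥`, of the formal balls that are refined by the ball with centre `0` and
radius `1`. -/
def bot (L : Type*) [Order.Frame L] : BallFilterAboveBot L where
  ball b := ⨆ _ : (FormalBall.zero 1 one_pos).Refines b, ⊤
  mono h := iSup_mono' fun h' => ⟨h'.trans h, le_rfl⟩
  inh := le_iSup_of_le (.zero 2 two_pos)
    (le_iSup_of_le (by simp [FormalBall.Refines, FormalBall.zero]) le_rfl)
  filter b c := by
    simp only [iSup_inf_eq, top_inf_eq]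
    refine iSup_le fun hb => iSup_le fun hc => ?_
    simp only [FormalBall.Refines, FormalBall.zero] at hb hc
    obtain ⟨ε, hε₁, hε₂⟩ := exists_between (lt_min (sub_pos.2 hb) (sub_pos.2 hc))
    rw [lt_min_iff] at hε₂
    refine le_iSup_of_le (.zero (1 + ε) (by positivity))
      (le_iSup₂_of_le ?_ ?_ (le_iSup_of_le ?_ le_rfl)) <;>
    simp only [FormalBall.Refines, FormalBall.zero] at hb hc ⊢
    · linarith [hε₂.1]
    · linarith [hε₂.2]
    · simp [hε₁]
  above_bot ε hε := le_iSup_of_le (by simp [FormalBall.Refines, FormalBall.zero, hε]) le_rfl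

end BallFilterAboveBot

namespace DedekindSection

variable {L : Type*} [Order.Frame L] (x : DedekindSection L)

/-- There is a dyadic rational strictly between any two rationals. -/
theorem exists_dyadic_between {a b : ℚ} (h : a < b) :
    ∃ (k : ℤ) (n : ℕ), a < (k / 2 ^ n : ℚ) ∧ (k / 2 ^ n : ℚ) < b := by
  obtain ⟨n, hn⟩ := exists_pow_lt_of_lt_one (sub_pos.2 h) (show (1 / 2 : ℚ) < 1 by norm_num)
  have h2 : (0 : ℚ) < 2 ^ n := by positivity
  have hn' : 1 < (b - a) * 2 ^ n := by
    rw [one_div, inv_pow] at hn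
    have := mul_lt_mul_of_pos_right hn h2
    rwa [inv_mul_cancel₀ h2.ne'] at this
  refine ⟨⌊a * 2 ^ n⌋ + 1, n, ?_, ?_⟩
  · rw [lt_div_iff₀ h2]
    push_cast
    exact Int.lt_floor_add_one _
  · rw [div_lt_iff₀ h2]
    push_cast
    have := Int.floor_le (a * 2 ^ n)
    linarith

/-- A Dedekind section has arbitrarily good approximations in `D`. -/
theorem approx_dyadic {ε : ℚ} (hε : 0 < ε) :
    ⊤ ≤ ⨆ d : DyadicUnit, x.lower (d.1 - ε) ⊓ x.upper (d.1 + ε) := by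
  refine Order.Frame.le_of_cover (x.approx hε) fun a => ?_
  rw [inf_top_eq]
  rcases le_or_gt 1 a with ha | ha
  · rw [x.lower_eq_bot ha, bot_inf_eq]; exact bot_le
  rcases le_or_gt (a + ε) (-1) with ha' | ha'
  · rw [x.upper_eq_bot ha', inf_bot_eq]; exact bot_le
  have : max a (-1) < min (a + ε) 1 := by
    simp only [max_lt_iff, lt_min_iff]
    exact ⟨⟨by linarith, ha'⟩, ⟨ha, by norm_num⟩⟩
  obtain ⟨k, n, h₁, h₂⟩ := exists_dyadic_between this
  rw [max_lt_iff] at h₁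
  rw [lt_min_iff] at h₂
  refine le_iSup_of_le ⟨k / 2 ^ n, h₁.2, h₂.2, k, n, rfl⟩ (inf_le_inf ?_ ?_)
  · exact x.lower_anti (by dsimp only; linarith)
  · exact x.upper_monotone (by dsimp only; linarith)

/-- The rounded filter of the formal balls `(q, δ)` with `q - δ < x < q + δ`. -/
def toBallFilter : BallFilterAboveBot L where
  ball b := x.lower (b.centre.1 - b.radius) ⊓ x.upper (b.centre.1 + b.radius)
  mono {b c} h := by
    unfold FormalBall.Refines at h
    have h₁ := le_abs_self (c.centre.1 - b.centre.1)
    have h₂ := neg_abs_le (c.centre.1 - b.centre.1)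
    exact inf_le_inf (x.lower_anti (by linarith)) (x.upper_monotone (by linarith))
  inh := (x.approx_dyadic one_pos).trans
    (iSup_le fun d => le_iSup_of_le ⟨d, 1, one_pos⟩ le_rfl)
  filter b c := by
    have key : ∀ l u : ℚ, x.lower l ⊓ x.upper u ≤
        ⨆ (d : FormalBall) (_ : l < d.centre.1 - d.radius ∧ d.centre.1 + d.radius < u),
          x.lower (d.centre.1 - d.radius) ⊓ x.upper (d.centre.1 + d.radius) := by
      intro l u
      refine (inf_le_inf (x.lower_round l) (x.upper_round u)).trans ?_
      simp only [iSup_inf_eq, inf_iSup_eq]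
      refine iSup₂_le fun u' hu => iSup₂_le fun l' hl => ?_
      obtain ⟨η, hη, hη'⟩ := exists_between (lt_min (sub_pos.2 hl) (sub_pos.2 hu))
      rw [lt_min_iff] at hη'
      refine Order.Frame.le_of_cover (x.approx_dyadic (half_pos hη)) fun d => ?_
      rcases le_or_gt (d.1 + η / 2) l' with h | h
      · refine le_trans ?_ bot_le
        rw [← x.lower_inf_upper h]
        exact le_inf (inf_le_right.trans inf_le_left) (inf_le_left.trans inf_le_right)
      rcases le_or_gt u' (d.1 - η / 2) with h' | h'
      · refine le_trans ?_ bot_le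
        rw [← x.lower_inf_upper h']
        exact le_inf (inf_le_left.trans inf_le_left) (inf_le_right.trans inf_le_right)
      refine le_iSup₂_of_le ⟨d, η / 2, half_pos hη⟩ ⟨?_, ?_⟩ inf_le_left
      · dsimp only; linarith [hη'.1]
      · dsimp only; linarith [hη'.2]
    have h1 : ∀ {l₁ l₂ : ℚ}, x.lower l₁ ⊓ x.lower l₂ ≤ x.lower (max l₁ l₂) := fun {l₁ l₂} => by
      rcases max_choice l₁ l₂ with h | h <;> rw [h]
      exacts [inf_le_left, inf_le_right]
    have h2 : ∀ {l₁ l₂ : ℚ}, x.upper l₁ ⊓ x.upper l₂ ≤ x.upper (min l₁ l₂) := fun {l₁ l₂} => by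
      rcases min_choice l₁ l₂ with h | h <;> rw [h]
      exacts [inf_le_left, inf_le_right]
    rw [inf_inf_inf_comm]
    refine ((inf_le_inf h1 h2).trans (key _ _)).trans ?_
    refine iSup₂_le fun d hd => ?_
    simp only [max_lt_iff, lt_min_iff] at hd
    obtain ⟨⟨h₁, h₂⟩, h₃, h₄⟩ := hd
    refine le_iSup₂_of_le d ?_ (le_iSup_of_le ?_ le_rfl) <;> unfold FormalBall.Refines
    · rw [← lt_sub_iff_add_lt, abs_lt]; constructor <;> linarith
    · rw [← lt_sub_iff_add_lt, abs_lt]; constructor <;> linarith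
  above_bot ε hε := by
    simp only [FormalBall.zero]
    rw [x.lower_eq_top (by linarith), x.upper_eq_top (by linarith), inf_top_eq]

/-- The extended midpoint operation `m'(x, F)`, for a point `x` of `[-1, 1]` and a rounded filter
`F ⊒ ⊥`: the set of the formal balls that are refined by the midpoint of a ball in `x` and a
ball in `F`. -/
def midpointBall (F : BallFilterAboveBot L) : BallFilterAboveBot L where
  ball p := ⨆ (b : FormalBall) (c : FormalBall) (_ : (b.midpoint c).Refines p),
    x.toBallFilter.ball b ⊓ F.ball c
  mono h := iSup₂_mono fun b c => iSup_mono' fun h' => ⟨h'.trans h, le_rfl⟩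
  inh := by
    refine Order.Frame.le_of_cover x.toBallFilter.inh fun b => ?_
    refine Order.Frame.le_of_cover F.inh fun c => ?_
    rw [inf_top_eq]
    let p : FormalBall := ⟨(b.midpoint c).centre, (b.midpoint c).radius + 1, by
      have := (b.midpoint c).radius_pos
      positivity⟩
    refine le_iSup_of_le p (le_iSup₂_of_le b c (le_iSup_of_le ?_ (inf_comm _ _).le))
    simp [p, FormalBall.Refines]
  filter p p' := by
    have key : ∀ (G : BallFilter L) (b c : FormalBall), G.ball b ⊓ G.ball c ≤
        ⨆ (d : FormalBall) (_ : d.Refines b) (_ : d.Refines c) (e : FormalBall) (_ : e.Refines d),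
          G.ball e := fun G b c => (G.filter b c).trans <|
      iSup₂_mono fun d _ => iSup_mono fun _ => G.round d
    simp only [iSup_inf_eq, inf_iSup_eq]
    refine iSup₂_le fun b' c' => iSup_le fun h' => iSup₂_le fun b c => iSup_le fun h => ?_
    rw [inf_inf_inf_comm]
    refine (inf_le_inf (key x.toBallFilter.toBallFilter b b') (key F.toBallFilter c c')).trans ?_
    simp only [iSup_inf_eq, inf_iSup_eq]
    refine iSup₂_le fun e hec => iSup_le fun hec' => iSup₂_le fun e' he' => ?_
    refine iSup₂_le fun d hdb => iSup_le fun hdb' => iSup₂_le fun d' hd' => ?_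
    refine le_iSup₂_of_le (d.midpoint e) ((hdb.midpoint hec).trans h)
      (le_iSup_of_le ((hdb'.midpoint hec').trans h') ?_)
    exact le_iSup₂_of_le d' e' (le_iSup_of_le (hd'.midpoint he') le_rfl)
  above_bot ε hε := by
    refine Order.Frame.le_of_cover (x.approx_dyadic (show 0 < ε / 4 by positivity)) fun d => ?_
    rw [inf_top_eq]
    refine le_iSup₂_of_le ⟨d, ε / 4, by positivity⟩ (.zero (1 + ε / 2) (by positivity))
      (le_iSup_of_le ?_ (le_inf le_rfl (le_top.trans (F.above_bot (ε / 2) (half_pos hε)))))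
    obtain ⟨q, h₁, h₂, -⟩ := d
    simp only [FormalBall.Refines, FormalBall.midpoint, FormalBall.zero]
    have : |0 - (q + 0) / 2| < 1 / 2 := abs_lt.2 ⟨by linarith, by linarith⟩
    linarith

end DedekindSection

/-! ### The radius map -/

/-- An upper real in `[0, ∞)` in a frame `L`, that is, an inhabited rounded up-closed set of
positive rationals: `mem q` is the truth value of `r < q`. -/
structure UpperReal (L : Type*) [Order.Frame L] where
  mem : {q : ℚ // 0 < q} → L
  mono : ∀ {q r : {q : ℚ // 0 < q}}, q < r → mem q ≤ mem r
  round : ∀ r : {q : ℚ // 0 < q}, mem r ≤ ⨆ (q : {q : ℚ // 0 < q}) (_ : q < r), mem q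
  inh : ⊤ ≤ ⨆ q, mem q

/-- The generator `[0, q)` in the free frame. -/
abbrev upperGen (q : {q : ℚ // 0 < q}) : FreeFrame (ULift.{u} {q : ℚ // 0 < q}) :=
  FreeFrame.gen (.up q)

/-- The relations that present the frame of opens of the locale of upper reals in `[0, ∞)`. -/
inductive UpperRealRel : FreeFrame (ULift.{u} {q : ℚ // 0 < q}) →
    FreeFrame (ULift.{u} {q : ℚ // 0 < q}) → Prop
  | mono {q r : {q : ℚ // 0 < q}} : q < r → UpperRealRel (upperGen q) (upperGen r)
  | round (r : {q : ℚ // 0 < q}) :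
      UpperRealRel (upperGen r) (⨆ (q : {q : ℚ // 0 < q}) (_ : q < r), upperGen q)
  | inh : UpperRealRel ⊤ (⨆ q, upperGen q)

/-- The locale `[0, ∞)` of upper reals. -/
def Locale.upperReal : Locale.{u} := Locale.of (Pres UpperRealRel.{u})

/-- The frame homomorphism that an upper real determines. -/
def UpperReal.toHom {L : Type*} [Order.Frame L] (s : UpperReal L) :
    FrameHom (Pres UpperRealRel.{u}) L :=
  Pres.lift (fun q => s.mem q.down) <| by
    rintro _ _ (h | r | _)
    · simpa using s.mono h
    · simpa [map_iSup] using s.round r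
    · simpa [map_iSup] using s.inh

/-- The upper real `0`. -/
def UpperReal.zero (L : Type*) [Order.Frame L] : UpperReal L where
  mem _ := ⊤
  mono _ := le_rfl
  round r := le_iSup₂_of_le ⟨r.1 / 2, half_pos r.2⟩ (Subtype.mk_lt_mk.2 (half_lt_self r.2)) le_rfl
  inh := le_iSup_of_le ⟨1, one_pos⟩ le_rfl

/-- The radius of a rounded filter: the infimum of the radii of its formal balls. -/
def BallFilter.radius {L : Type*} [Order.Frame L] (F : BallFilter L) : UpperReal L where
  mem q := ⨆ (b : FormalBall) (_ : b.radius < q.1), F.ball b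
  mono h := iSup_mono fun _ => iSup_mono' fun h' => ⟨h'.trans h, le_rfl⟩
  round r := by
    refine iSup₂_le fun b hb => ?_
    obtain ⟨q, h₁, h₂⟩ := exists_between hb
    exact le_iSup₂_of_le ⟨q, b.radius_pos.trans h₁⟩ h₂ (le_iSup₂_of_le b h₁ le_rfl)
  inh := F.inh.trans <| iSup_le fun b => le_iSup_of_le ⟨b.radius + 1, by
    have := b.radius_pos
    positivity⟩ (le_iSup₂_of_le b (lt_add_one _) le_rfl)

namespace Locale

/-- The embedding `i` of `[-1, 1]` into the ball domain, as a map to `B`. -/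
def intervalToBall : interval.{u} ⟶ ballDomainAboveBot.{u} :=
  homMk ((DedekindSection.ofHom (inv (𝟙 interval))).toBallFilter.toHom)

/-- The inclusion of `B` in the ball domain. -/
def ballInclusion : ballDomainAboveBot.{u} ⟶ ballDomain.{u} :=
  homMk ((BallFilterAboveBot.ofHom (inv (𝟙 ballDomainAboveBot))).toBallFilter.toHom)

/-- The radius map `r`, from the ball domain to the upper reals. -/
def radius : ballDomain.{u} ⟶ upperReal.{u} :=
  homMk ((BallFilter.ofHom (inv (𝟙 ballDomain))).radius.toHom)

/-- The constant map with value the upper real `0`. -/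
def zeroRadius (X : Locale.{u}) : X ⟶ upperReal.{u} := homMk (UpperReal.zero X).toHom

/-- The constant map with value the point `⊥` of `B`. -/
def botBall (X : Locale.{u}) : X ⟶ ballDomainAboveBot.{u} := homMk (BallFilterAboveBot.bot X).toHom

/-- The extended midpoint map `m' : [-1, 1] × B ⟶ B`. -/
def midpointBall : (interval.{u} ⊗ ballDomainAboveBot.{u}) ⟶ ballDomainAboveBot.{u} :=
  homMk (((DedekindSection.ofHom (inv (fst interval ballDomainAboveBot))).midpointBall
    (BallFilterAboveBot.ofHom (inv (snd interval ballDomainAboveBot)))).toHom)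

/-- The operator `T (f) = m' ∘ ([-1, 1] × f) ∘ ⟨h, t⟩` on the maps from `X` to `B`. -/
def iterationOp {X : Locale.{u}} (h : X ⟶ interval) (t : X ⟶ X) (f : X ⟶ ballDomainAboveBot) :
    X ⟶ ballDomainAboveBot :=
  lift h t ≫ (interval ◁ f) ≫ midpointBall

end Locale

/-! A map into the interval is a Dedekind section in the frame of opens of its domain, and a map
into `B` is a rounded filter there. Composition with `t` applies the frame homomorphism `inv t`. The
theorem thus becomes one about sections and filters in a frame `L` with an endomorphism `τ`, where
`T` becomes the operator `iterationStep`, which sends `F` to `m'(h, τ F)`.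

This operator is monotone and preserves suprema of increasing sequences, so Kleene's argument makes
the supremum of its iterates at `⊥` the least fixpoint (`iterationStep_iterationSup`,
`iterationSup_le`). The section `h` has radius `0`, so each step halves the radius. As `⊥` has
radius `1`, the supremum has radius `0` (`radius_iterate_bot`). A filter of radius `0` is the image
of a section under the embedding `i` (`toBallFilter_toSection`). The embedding carries `m` to `m'`
(`midpointBall_toBallFilter`), so this section solves the equation.

Uniqueness comes from the discreteness of the order on sections (`eq_of_le`). Any solution gives a
fixpoint, the least fixpoint lies below it, and `i` reflects this inequality to an equality
(`eq_of_toBallFilter_le`). Discreteness also reduces the midpoint axioms to inequalities in one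
direction. -/

namespace DedekindSection

/-! ### Dedekind sections: discreteness of the order and the midpoint axioms -/

variable {L K : Type*} [Order.Frame L] [Order.Frame K]

theorem ext_of_eq {x y : DedekindSection L} (hl : ∀ q, x.lower q = y.lower q)
    (hu : ∀ q, x.upper q = y.upper q) : x = y := by
  cases x; cases y
  obtain rfl : _ = _ := funext hl
  obtain rfl : _ = _ := funext hu
  rfl

/-- The specialization order on Dedekind sections is discrete. -/
theorem eq_of_le {x y : DedekindSection L} (hl : ∀ q, x.lower q ≤ y.lower q)
    (hu : ∀ q, x.upper q ≤ y.upper q) : x = y := by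
  refine ext_of_eq (fun q => (hl q).antisymm ?_) (fun r => (hu r).antisymm ?_)
  · refine (y.lower_round q).trans (iSup₂_le fun r hr => ?_)
    -- By locatedness of `x` at `q < r`, either `x.lower q` holds, as wanted, or `x.upper r` does.
    -- The latter gives `y.upper r`, which is disjoint from `y.lower r`.
    rw [← inf_top_eq (y.lower r), ← top_le_iff.1 (x.located hr), inf_sup_left]
    exact sup_le inf_le_right
      (((inf_le_inf_left _ (hu r)).trans (y.disj r)).trans bot_le)
  · refine (y.upper_round r).trans (iSup₂_le fun q hq => ?_)
    rw [← inf_top_eq (y.upper q), ← top_le_iff.1 (x.located hq), inf_sup_left]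
    refine sup_le (le_trans ?_ bot_le) inf_le_right
    exact (inf_comm _ _).le.trans ((inf_le_inf_right _ (hl q)).trans (y.disj q))

/-- The image of a Dedekind section under a frame homomorphism. -/
def map (φ : FrameHom L K) (x : DedekindSection L) : DedekindSection K where
  lower q := φ (x.lower q)
  upper q := φ (x.upper q)
  lower_mono h := OrderHomClass.mono φ (x.lower_mono h)
  lower_round q := by simpa [map_iSup] using OrderHomClass.mono φ (x.lower_round q)
  lower_inh := by simpa [map_iSup] using OrderHomClass.mono φ x.lower_inh
  upper_mono h := OrderHomClass.mono φ (x.upper_mono h)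
  upper_round q := by simpa [map_iSup] using OrderHomClass.mono φ (x.upper_round q)
  upper_inh := by simpa [map_iSup] using OrderHomClass.mono φ x.upper_inh
  disj q := by simpa using OrderHomClass.mono φ (x.disj q)
  located h := by simpa using OrderHomClass.mono φ (x.located h)
  lower_one := by simpa using OrderHomClass.mono φ x.lower_one
  upper_neg_one := by simpa using OrderHomClass.mono φ x.upper_neg_one

@[simp]
theorem ofHom_toHom (x : DedekindSection L) : ofHom (toHom.{u} x) = x :=
  ext_of_eq (fun _ => Pres.lift_gen _ _ _) (fun _ => Pres.lift_gen _ _ _)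

theorem ofHom_injective {φ ψ : FrameHom (Pres IntervalRel.{u}) L} (h : ofHom φ = ofHom ψ) :
    φ = ψ := by
  refine Pres.hom_ext ?_
  rintro (q | q)
  · exact congrFun (congrArg lower h) q
  · exact congrFun (congrArg upper h) q

/-- By `eq_of_le` one direction suffices: if `q` lies below the mean of `a` and `b`, it lies below
the larger of the two; dually for upper bounds. -/
theorem midpoint_self (x : DedekindSection L) : x.midpoint x = x := by
  refine eq_of_le (fun q => ?_) (fun q => ?_)
  · refine iSup₂_le fun a b => iSup_le fun h => ?_
    rcases le_total a b with hab | hab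
    · exact inf_le_right.trans (x.lower_anti (by linarith))
    · exact inf_le_left.trans (x.lower_anti (by linarith))
  · refine iSup₂_le fun a b => iSup_le fun h => ?_
    rcases le_total a b with hab | hab
    · exact inf_le_left.trans (x.upper_monotone (by linarith))
    · exact inf_le_right.trans (x.upper_monotone (by linarith))

theorem midpoint_comm (x y : DedekindSection L) : x.midpoint y = y.midpoint x := by
  refine eq_of_le (fun q => ?_) (fun q => ?_) <;>
  exact iSup₂_le fun a b => iSup_le fun h =>
    le_iSup₂_of_le b a (le_iSup_of_le (by linarith) (inf_comm _ _).le)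

theorem midpoint_medial (x y z w : DedekindSection L) :
    (x.midpoint y).midpoint (z.midpoint w) = (x.midpoint z).midpoint (y.midpoint w) := by
  refine eq_of_le (fun q => ?_) (fun q => ?_)
  · refine iSup₂_le fun a b => iSup_le fun h => ?_
    simp only [midpoint, iSup_inf_eq, inf_iSup_eq]
    refine iSup₂_le fun e f => iSup_le fun hef => iSup₂_le fun c d => iSup_le fun hcd => ?_
    rw [inf_inf_inf_comm]
    -- The slack `(c + d + e + f) / 4 - q` is positive. Lowering both regrouped means by half of it
    -- makes them strict bounds for the inner midpoints, while their mean still exceeds `q`.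
    refine le_iSup₂_of_le ((c + e) / 2 - ((c + d + e + f) / 4 - q) / 2)
      ((d + f) / 2 - ((c + d + e + f) / 4 - q) / 2) (le_iSup_of_le (by linarith) ?_)
    refine le_iSup₂_of_le d f (le_iSup_of_le (by linarith) ?_)
    exact le_iSup₂_of_le c e (le_iSup_of_le (by linarith) le_rfl)
  · refine iSup₂_le fun a b => iSup_le fun h => ?_
    simp only [midpoint, iSup_inf_eq, inf_iSup_eq]
    refine iSup₂_le fun e f => iSup_le fun hef => iSup₂_le fun c d => iSup_le fun hcd => ?_
    rw [inf_inf_inf_comm]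
    refine le_iSup₂_of_le ((c + e) / 2 + (q - (c + d + e + f) / 4) / 2)
      ((d + f) / 2 + (q - (c + d + e + f) / 4) / 2) (le_iSup_of_le (by linarith) ?_)
    refine le_iSup₂_of_le d f (le_iSup_of_le (by linarith) ?_)
    exact le_iSup₂_of_le c e (le_iSup_of_le (by linarith) le_rfl)

/-- Every open interval around a Dedekind section contains a smaller formal ball around it. -/
theorem lower_inf_upper_le (x : DedekindSection L) (l u : ℚ) : x.lower l ⊓ x.upper u ≤
    ⨆ (d : FormalBall) (_ : l < d.centre.1 - d.radius ∧ d.centre.1 + d.radius < u),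
      x.toBallFilter.ball d := by
  refine (inf_le_inf (x.lower_round l) (x.upper_round u)).trans ?_
  simp only [iSup_inf_eq, inf_iSup_eq]
  refine iSup₂_le fun u' hu => iSup₂_le fun l' hl => ?_
  -- The ball will have radius `η / 2`. If it meets the interval from `l'` to `u'`, its diameter
  -- `η`, smaller than both gaps, keeps it inside the interval from `l` to `u`. If it misses that
  -- interval, the section cannot lie in both.
  obtain ⟨η, hη, hη'⟩ := exists_between (lt_min (sub_pos.2 hl) (sub_pos.2 hu))
  rw [lt_min_iff] at hη'
  refine Order.Frame.le_of_cover (x.approx_dyadic (half_pos hη)) fun d => ?_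
  rcases le_or_gt (d.1 + η / 2) l' with h | h
  · refine le_trans ?_ bot_le
    rw [← x.lower_inf_upper h]
    exact le_inf (inf_le_right.trans inf_le_left) (inf_le_left.trans inf_le_right)
  rcases le_or_gt u' (d.1 - η / 2) with h' | h'
  · refine le_trans ?_ bot_le
    rw [← x.lower_inf_upper h']
    exact le_inf (inf_le_left.trans inf_le_left) (inf_le_right.trans inf_le_right)
  refine le_iSup₂_of_le ⟨d, η / 2, half_pos hη⟩ ⟨?_, ?_⟩ inf_le_left
  · dsimp only; linarith [hη'.1]
  · dsimp only; linarith [hη'.2]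

end DedekindSection

/-! ### Rounded filters: order, directed suprema, and filters of radius zero -/

namespace BallFilterAboveBot

variable {L K : Type*} [Order.Frame L] [Order.Frame K]

theorem ext_of_eq {F G : BallFilterAboveBot L} (h : ∀ b, F.ball b = G.ball b) : F = G := by
  obtain ⟨⟨F, _, _, _⟩, _⟩ := F
  obtain ⟨⟨G, _, _, _⟩, _⟩ := G
  obtain rfl : F = G := funext h
  rfl

/-- The specialization order on rounded filters. -/
instance : PartialOrder (BallFilterAboveBot L) where
  le F G := ∀ b, F.ball b ≤ G.ball b
  le_refl F b := le_rfl
  le_trans F G H h₁ h₂ b := (h₁ b).trans (h₂ b)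
  le_antisymm F G h₁ h₂ := ext_of_eq fun b => (h₁ b).antisymm (h₂ b)

/-- The image of a rounded filter under a frame homomorphism. -/
def map (φ : FrameHom L K) (F : BallFilterAboveBot L) : BallFilterAboveBot K where
  ball b := φ (F.ball b)
  mono h := OrderHomClass.mono φ (F.mono h)
  inh := by simpa [map_iSup] using OrderHomClass.mono φ F.inh
  filter b c := by simpa [map_iSup] using OrderHomClass.mono φ (F.filter b c)
  above_bot ε hε := by simpa using OrderHomClass.mono φ (F.above_bot ε hε)

@[simp]
theorem ofHom_toHom (F : BallFilterAboveBot L) : ofHom (toHom.{u} F) = F :=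
  ext_of_eq fun _ => Pres.lift_gen _ _ _

theorem toHom_ofHom (φ : FrameHom (Pres BallRelAboveBot.{u}) L) : (ofHom φ).toHom = φ :=
  Pres.hom_ext fun _ => Pres.lift_gen _ _ _

/-- Every open is a join of finite meets of formal balls, so the specialization order can be tested
on the balls alone. -/
theorem toHom_le_toHom {F G : BallFilterAboveBot L} (h : F ≤ G) (U : Pres BallRelAboveBot.{u}) :
    F.toHom U ≤ G.toHom U := by
  change FreeFrame.lift _ _ ≤ FreeFrame.lift _ _
  rw [FreeFrame.lift_apply, FreeFrame.lift_apply]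
  exact iSup₂_mono fun s _ => Finset.inf_mono_fun fun b _ => h b.down

/-- The refinement is strict, so a ball refined by `(0, 1)` is also refined by `(0, 1 + ε)` for some
`ε > 0`, and the latter belongs to every filter in `B`. -/
theorem bot_le (F : BallFilterAboveBot L) : bot L ≤ F := by
  refine fun b => iSup_le fun hb => ?_
  obtain ⟨ε, hε, hε'⟩ := exists_between (sub_pos.2 hb)
  refine (F.above_bot ε hε).trans (F.mono ?_)
  simp only [FormalBall.Refines, FormalBall.zero] at hε' ⊢
  linarith

/-- The supremum of an increasing sequence of rounded filters. -/
def iSupNat (F : ℕ → BallFilterAboveBot L) (hF : Monotone F) : BallFilterAboveBot L where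
  ball b := ⨆ n, (F n).ball b
  mono h := iSup_mono fun n => (F n).mono h
  inh := (F 0).inh.trans (iSup_mono fun b => le_iSup (fun n => (F n).ball b) 0)
  filter b c := by
    simp only [iSup_inf_eq, inf_iSup_eq]
    refine iSup₂_le fun n m => ?_
    -- Monotonicity brings both balls into one stage of the sequence, whose own filter property then
    -- applies.
    refine (inf_le_inf (hF (le_max_right n m) b) (hF (le_max_left n m) c)).trans ?_
    refine ((F _).filter b c).trans (iSup_mono fun d => iSup₂_mono fun _ _ => ?_)
    exact le_iSup (fun n => (F n).ball d) _
  above_bot ε hε := le_iSup_of_le 0 ((F 0).above_bot ε hε)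

theorem isLUB_iSupNat (F : ℕ → BallFilterAboveBot L) (hF : Monotone F) :
    IsLUB (Set.range F) (iSupNat F hF) := by
  constructor
  · rintro _ ⟨n, rfl⟩ b
    exact le_iSup (fun n => (F n).ball b) n
  · exact fun G hG b => iSup_le fun n => hG ⟨n, rfl⟩ b

/-- The Dedekind section of a rounded filter with radius `0`. -/
def toSection (F : BallFilterAboveBot L)
    (hF : ∀ q : ℚ, 0 < q → ⊤ ≤ ⨆ (b : FormalBall) (_ : b.radius < q), F.ball b) :
    DedekindSection L where
  lower q := ⨆ (b : FormalBall) (_ : q < b.centre.1 - b.radius), F.ball b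
  upper q := ⨆ (b : FormalBall) (_ : b.centre.1 + b.radius < q), F.ball b
  lower_mono h := iSup_mono fun _ => iSup_mono' fun h' => ⟨h.trans h', le_rfl⟩
  lower_round q := by
    refine iSup₂_le fun b hb => ?_
    obtain ⟨r, h₁, h₂⟩ := exists_between hb
    exact le_iSup₂_of_le r h₁ (le_iSup₂_of_le b h₂ le_rfl)
  lower_inh := F.inh.trans <| iSup_le fun b =>
    le_iSup_of_le (b.centre.1 - b.radius - 1) (le_iSup₂_of_le b (sub_one_lt _) le_rfl)
  upper_mono h := iSup_mono fun _ => iSup_mono' fun h' => ⟨h'.trans h, le_rfl⟩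
  upper_round q := by
    refine iSup₂_le fun b hb => ?_
    obtain ⟨r, h₁, h₂⟩ := exists_between hb
    exact le_iSup₂_of_le r h₂ (le_iSup₂_of_le b h₁ le_rfl)
  upper_inh := F.inh.trans <| iSup_le fun b =>
    le_iSup_of_le (b.centre.1 + b.radius + 1) (le_iSup₂_of_le b (lt_add_one _) le_rfl)
  disj q := by
    simp only [iSup_inf_eq, inf_iSup_eq]
    refine iSup₂_le fun c hc => iSup₂_le fun b hb => (F.filter b c).trans ?_
    -- A common refinement would lie both to the right and to the left of `q`.
    refine iSup_le fun d => iSup₂_le fun hdb hdc => False.elim ?_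
    unfold FormalBall.Refines at hdb hdc
    have h₁ := le_abs_self (b.centre.1 - d.centre.1)
    have h₂ := neg_abs_le (c.centre.1 - d.centre.1)
    have := d.radius_pos
    linarith
  located {q r} h := by
    -- This is where radius `0` is needed: a ball of diameter less than `r - q` cannot contain both
    -- `q` and `r`.
    refine (hF ((r - q) / 2) (by linarith)).trans (iSup₂_le fun b hb => ?_)
    rcases lt_or_ge q (b.centre.1 - b.radius) with hq | hq
    · exact le_sup_of_le_left (le_iSup₂_of_le b hq le_rfl)
    · exact le_sup_of_le_right (le_iSup₂_of_le b (by linarith) le_rfl)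
  lower_one := iSup₂_le fun b hb => by
    have := b.centre.2.2.1
    have := b.radius_pos
    linarith
  upper_neg_one := iSup₂_le fun b hb => by
    have := b.centre.2.1
    have := b.radius_pos
    linarith

/-- This puts filters of radius `0` in the image of the embedding. If one ball of `F` starts to the
right of the left end of `b` and another stops to the left of its right end, any common refinement
refines `b`. Conversely, roundedness yields a ball of `F` strictly inside `b`, which gives both
bounds. -/
theorem toBallFilter_toSection (F : BallFilterAboveBot L)
    (hF : ∀ q : ℚ, 0 < q → ⊤ ≤ ⨆ (b : FormalBall) (_ : b.radius < q), F.ball b) :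
    (F.toSection hF).toBallFilter = F := by
  refine le_antisymm (fun b => ?_) (fun b => ?_)
  · simp only [DedekindSection.toBallFilter, toSection, iSup_inf_eq, inf_iSup_eq]
    refine iSup₂_le fun d hd => iSup₂_le fun c hc => (F.filter c d).trans ?_
    refine iSup_le fun e => iSup₂_le fun hec hed => F.mono ?_
    unfold FormalBall.Refines at *
    have h₁ := le_abs_self (c.centre.1 - e.centre.1)
    have h₂ := neg_abs_le (d.centre.1 - e.centre.1)
    rw [← lt_sub_iff_add_lt, abs_lt]
    constructor <;> linarith
  · refine (F.round b).trans (iSup₂_le fun c hc => le_inf ?_ ?_)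
    · refine le_iSup₂_of_le c ?_ le_rfl
      unfold FormalBall.Refines at hc
      have := le_abs_self (b.centre.1 - c.centre.1)
      linarith
    · refine le_iSup₂_of_le c ?_ le_rfl
      unfold FormalBall.Refines at hc
      have := neg_abs_le (b.centre.1 - c.centre.1)
      linarith

end BallFilterAboveBot

/-! ### The embedding of sections in filters and the extended midpoint -/

namespace DedekindSection

variable {L K : Type*} [Order.Frame L] [Order.Frame K]

theorem radius_toBallFilter (x : DedekindSection L) {q : ℚ} (hq : 0 < q) :
    ⊤ ≤ ⨆ (b : FormalBall) (_ : b.radius < q), x.toBallFilter.ball b :=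
  (x.approx_dyadic (half_pos hq)).trans <| iSup_le fun d =>
    le_iSup₂_of_le ⟨d, q / 2, half_pos hq⟩ (half_lt_self hq) le_rfl

/-- The embedding of the Dedekind reals in the ball domain reflects the specialization order. -/
theorem eq_of_toBallFilter_le {x y : DedekindSection L} (h : x.toBallFilter ≤ y.toBallFilter) :
    x = y := by
  refine eq_of_le (fun q => ?_) (fun q => ?_)
  -- The vacuous bound `x < 2` turns the half-line into an interval, to which `lower_inf_upper_le`
  -- applies.
  · rw [← inf_top_eq (x.lower q), ← x.upper_eq_top one_lt_two]
    refine (x.lower_inf_upper_le q 2).trans (iSup₂_le fun d hd => (h d).trans ?_)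
    exact inf_le_left.trans (y.lower_anti hd.1.le)
  · rw [← top_inf_eq (x.upper q), ← x.lower_eq_top (q := -2) (by norm_num)]
    refine (x.lower_inf_upper_le (-2) q).trans (iSup₂_le fun d hd => (h d).trans ?_)
    exact inf_le_right.trans (y.upper_monotone hd.2.le)

theorem map_toBallFilter (φ : FrameHom L K) (x : DedekindSection L) :
    (x.map φ).toBallFilter = x.toBallFilter.map φ :=
  BallFilterAboveBot.ext_of_eq fun _ => (map_inf φ _ _).symm

/-- The extended midpoint operation extends the midpoint operation. -/
theorem midpointBall_toBallFilter (x y : DedekindSection L) :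
    x.midpointBall y.toBallFilter = (x.midpoint y).toBallFilter := by
  refine le_antisymm (fun p => ?_) (fun p => ?_)
  · refine iSup₂_le fun b c => iSup_le fun h => ?_
    simp only [FormalBall.Refines, FormalBall.midpoint] at h
    have h₁ := le_abs_self (p.centre.1 - (b.centre.1 + c.centre.1) / 2)
    have h₂ := neg_abs_le (p.centre.1 - (b.centre.1 + c.centre.1) / 2)
    refine le_inf ?_ ?_
    · exact le_iSup₂_of_le (b.centre.1 - b.radius) (c.centre.1 - c.radius)
        (le_iSup_of_le (by linarith) (inf_le_inf inf_le_left inf_le_left))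
    · exact le_iSup₂_of_le (b.centre.1 + b.radius) (c.centre.1 + c.radius)
        (le_iSup_of_le (by linarith) (inf_le_inf inf_le_right inf_le_right))
  · simp only [toBallFilter, midpoint, iSup_inf_eq, inf_iSup_eq]
    refine iSup₂_le fun a' b' => iSup_le fun h' => iSup₂_le fun a b => iSup_le fun h => ?_
    rw [inf_inf_inf_comm]
    -- Balls inside the two intervals have a midpoint ball inside the interval of means, hence
    -- strictly inside `p`.
    refine (inf_le_inf (x.lower_inf_upper_le a a') (y.lower_inf_upper_le b b')).trans ?_
    simp only [iSup_inf_eq, inf_iSup_eq]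
    refine iSup₂_le fun e he => iSup₂_le fun d hd => ?_
    refine le_iSup₂_of_le d e (le_iSup_of_le ?_ le_rfl)
    simp only [FormalBall.Refines, FormalBall.midpoint]
    rw [← lt_sub_iff_add_lt, abs_lt]
    constructor <;> linarith [he.1, he.2, hd.1, hd.2]

theorem midpointBall_mono (x : DedekindSection L) {F G : BallFilterAboveBot L} (h : F ≤ G) :
    x.midpointBall F ≤ x.midpointBall G := fun _ =>
  iSup₂_mono fun _ c => iSup_mono fun _ => inf_le_inf_left _ (h c)

/-- The midpoint is built from finite meets and from joins indexed by rationals, all of which frame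
homomorphisms preserve. The same holds for `map_midpointBall`. -/
theorem map_midpoint (φ : FrameHom L K)
    (x y : DedekindSection L) : (x.midpoint y).map φ = (x.map φ).midpoint (y.map φ) := by
  refine ext_of_eq (fun q => ?_) (fun q => ?_) <;>
  simp [map, midpoint, map_iSup]

theorem map_midpointBall (φ : FrameHom L K)
    (x : DedekindSection L) (F : BallFilterAboveBot L) :
    (x.midpointBall F).map φ = (x.map φ).midpointBall (F.map φ) := by
  refine BallFilterAboveBot.ext_of_eq fun q => ?_
  simp [BallFilterAboveBot.map, map, midpointBall,
    toBallFilter, map_iSup]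

/-! ### Kleene iteration from `⊥` and the decay of the radius -/

/-- The operator `F ↦ m' (h, τ F)` on rounded filters. -/
def iterationStep (h : DedekindSection L) (τ : FrameHom L L) (F : BallFilterAboveBot L) :
    BallFilterAboveBot L := h.midpointBall (F.map τ)

section iteration

variable (h : DedekindSection L) (τ : FrameHom L L)

theorem iterationStep_mono : Monotone (h.iterationStep τ) := fun _ _ hFG =>
  h.midpointBall_mono fun b => OrderHomClass.mono τ (hFG b)

theorem monotone_iterate_bot :
    Monotone fun n : ℕ => (h.iterationStep τ)^[n] (BallFilterAboveBot.bot L) :=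
  (h.iterationStep_mono τ).monotone_iterate_of_le_map (BallFilterAboveBot.bot_le _)

/-- The supremum of the iterates of the operator at `⊥`. -/
def iterationSup : BallFilterAboveBot L := .iSupNat _ (h.monotone_iterate_bot τ)

theorem isLUB_iterationSup :
    IsLUB (Set.range fun n : ℕ => (h.iterationStep τ)^[n] (BallFilterAboveBot.bot L))
      (h.iterationSup τ) :=
  BallFilterAboveBot.isLUB_iSupNat _ _

theorem iterate_le_iterationSup (n : ℕ) :
    (h.iterationStep τ)^[n] (BallFilterAboveBot.bot L) ≤ h.iterationSup τ :=
  (h.isLUB_iterationSup τ).1 ⟨n, rfl⟩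

/-- The step commutes with the supremum because `τ` preserves joins and meets distribute over them.
The resulting index shift is harmless, since the iterates increase. -/
theorem iterationStep_iterationSup :
    h.iterationStep τ (h.iterationSup τ) = h.iterationSup τ := by
  refine le_antisymm (fun p => ?_) (fun p => iSup_le fun n => ?_)
  · refine iSup₂_le fun b c => iSup_le fun hbc => ?_
    change _ ⊓ τ (⨆ n, _) ≤ _
    rw [map_iSup, inf_iSup_eq]
    refine iSup_le fun n => le_iSup_of_le (n + 1) ?_
    simp only [Function.iterate_succ_apply']
    exact le_iSup₂_of_le b c (le_iSup_of_le hbc le_rfl)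
  · refine (h.monotone_iterate_bot τ n.le_succ p).trans ?_
    simp only [Function.iterate_succ_apply']
    exact h.iterationStep_mono τ (h.iterate_le_iterationSup τ n) p

theorem iterationSup_le {F : BallFilterAboveBot L} (hF : h.iterationStep τ F = F) :
    h.iterationSup τ ≤ F := by
  refine (h.isLUB_iterationSup τ).2 ?_
  rintro _ ⟨n, rfl⟩
  induction n with
  | zero => exact F.bot_le
  | succ n ih =>
    simp only [Function.iterate_succ_apply']
    exact (h.iterationStep_mono τ ih).trans hF.le

/-- The quantitative core: a midpoint with a section, which has radius `0`, halves the radius, and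
`⊥` has radius `1`. -/
theorem radius_iterate_bot (n : ℕ) {q : ℚ} (hq : (1 / 2) ^ n < q) :
    ⊤ ≤ ⨆ (b : FormalBall) (_ : b.radius < q),
      ((h.iterationStep τ)^[n] (BallFilterAboveBot.bot L)).ball b := by
  induction n generalizing q with
  | zero =>
    -- The ball `(0, 1)` itself is not in `⊥`, only the strictly larger ones, so a radius strictly
    -- between `1` and `q` is chosen.
    obtain ⟨r, h₁, h₂⟩ := exists_between hq
    refine le_iSup₂_of_le (.zero r ((by positivity : (0 : ℚ) < (1 / 2) ^ 0).trans h₁)) h₂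
      (le_iSup_of_le ?_ le_rfl)
    simpa [FormalBall.Refines, FormalBall.zero] using h₁
  | succ n ih =>
    obtain ⟨r, h₁, h₂⟩ := exists_between hq
    have hr : (1 / 2 : ℚ) ^ n < 2 * r := by
      rw [pow_succ] at h₁
      linarith
    -- Radii are external rationals, so `τ` carries the cover by small balls to a cover by balls of
    -- the same radii.
    have hτ := OrderHomClass.mono τ (ih hr)
    simp only [map_iSup, map_top] at hτ
    have hr0 : 0 < r := (by positivity : (0 : ℚ) < (1 / 2) ^ (n + 1)).trans h₁
    refine Order.Frame.le_of_cover (h.radius_toBallFilter (show 0 < q - r by linarith)) fun b => ?_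
    refine Order.Frame.le_of_cover hτ fun c => ?_
    simp only [iSup_inf_eq, inf_iSup_eq, inf_top_eq]
    refine iSup_le fun hb => iSup_le fun hc => ?_
    have hbq : (b.midpoint c).radius < q - (q - r) / 2 := by
      simp only [FormalBall.midpoint]
      linarith
    -- Radii below `q - r` and `2 * r` have a mean below `(q + r) / 2`, which is the radius taken
    -- here. The slight enlargement is needed because `midpointBall` contains the balls strictly
    -- refined by a midpoint.
    refine le_iSup₂_of_le ⟨(b.midpoint c).centre, q - (q - r) / 2,
      (b.midpoint c).radius_pos.trans hbq⟩ (by dsimp only; linarith) ?_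
    simp only [Function.iterate_succ_apply']
    refine le_iSup₂_of_le b c (le_iSup_of_le ?_ (inf_comm _ _).le)
    simpa [FormalBall.Refines] using hbq

theorem radius_iterationSup (q : ℚ) (hq : 0 < q) :
    ⊤ ≤ ⨆ (b : FormalBall) (_ : b.radius < q), (h.iterationSup τ).ball b := by
  obtain ⟨n, hn⟩ := exists_pow_lt_of_lt_one hq (show (1 / 2 : ℚ) < 1 by norm_num)
  exact (h.radius_iterate_bot τ n hn).trans <| iSup₂_mono fun b _ =>
    h.iterate_le_iterationSup τ n b

/-- The solution of the equation `M = m (h, τ M)`. -/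
def iterationSection : DedekindSection L :=
  (h.iterationSup τ).toSection (h.radius_iterationSup τ)

theorem toBallFilter_iterationSection :
    (h.iterationSection τ).toBallFilter = h.iterationSup τ :=
  BallFilterAboveBot.toBallFilter_toSection _ _

theorem iterationStep_toBallFilter (x : DedekindSection L) :
    h.iterationStep τ x.toBallFilter = (h.midpoint (x.map τ)).toBallFilter := by
  rw [iterationStep, ← map_toBallFilter, midpointBall_toBallFilter]

/-- A solution embeds as a fixpoint, so the least fixpoint, itself an embedded section, lies below
it; the embedding reflects this to equality. The converse reads the fixpoint equation back through
the embedding. -/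
theorem eq_midpoint_map_iff (x : DedekindSection L) :
    x = h.midpoint (x.map τ) ↔ x = h.iterationSection τ := by
  constructor
  · intro hx
    refine (eq_of_toBallFilter_le ?_).symm
    rw [toBallFilter_iterationSection]
    refine h.iterationSup_le τ ?_
    rw [iterationStep_toBallFilter, ← hx]
  · rintro rfl
    refine eq_of_toBallFilter_le ?_
    rw [← iterationStep_toBallFilter, toBallFilter_iterationSection, iterationStep_iterationSup]

end iteration

end DedekindSection

/-! ### Translation to maps of locales -/

theorem UpperReal.toHom_gen {L : Type*} [Order.Frame L] (s : UpperReal L)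
    (q : ULift.{u} {q : ℚ // 0 < q}) : s.toHom (Pres.gen _ q) = s.mem q.down :=
  Pres.lift_gen _ _ _

theorem BallFilter.toHom_gen {L : Type*} [Order.Frame L] (F : BallFilter L)
    (b : ULift.{u} FormalBall) : F.toHom (Pres.gen _ b) = F.ball b.down :=
  Pres.lift_gen _ _ _

namespace Locale

variable {X Y : Locale.{u}}

/-- The Dedekind section that a map to the locale `[-1, 1]` determines. -/
def toSection (f : X ⟶ interval.{u}) : DedekindSection X := DedekindSection.ofHom (inv f)

/-- The rounded filter that a map to `B` determines. -/
def toFilter (f : X ⟶ ballDomainAboveBot.{u}) : BallFilterAboveBot X :=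
  BallFilterAboveBot.ofHom (inv f)

theorem toSection_injective {f g : X ⟶ interval.{u}} (h : toSection f = toSection g) : f = g :=
  hom_ext (DedekindSection.ofHom_injective h)

@[simp]
theorem toSection_homMk (x : DedekindSection X) : toSection (homMk (Y := interval) x.toHom) = x :=
  DedekindSection.ofHom_toHom x

@[simp]
theorem toFilter_homMk (F : BallFilterAboveBot X) :
    toFilter (homMk (Y := ballDomainAboveBot) F.toHom) = F :=
  BallFilterAboveBot.ofHom_toHom F

theorem toFilter_le_iff {f g : X ⟶ ballDomainAboveBot.{u}} : toFilter f ≤ toFilter g ↔ f ≤ g := by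
  refine ⟨fun h U => ?_, fun h b => h _⟩
  have key (k : X ⟶ ballDomainAboveBot.{u}) : (toFilter k).toHom U = inv k U :=
    DFunLike.congr_fun (BallFilterAboveBot.toHom_ofHom (inv k)) U
  exact (key f).ge.trans ((BallFilterAboveBot.toHom_le_toHom h U).trans (key g).le)

theorem toFilter_injective {f g : X ⟶ ballDomainAboveBot.{u}} (h : toFilter f = toFilter g) :
    f = g :=
  le_antisymm (toFilter_le_iff.1 h.le) (toFilter_le_iff.1 h.ge)

theorem toSection_comp (t : X ⟶ Y) (f : Y ⟶ interval.{u}) :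
    toSection (t ≫ f) = (toSection f).map (inv t) := rfl

theorem toFilter_comp (t : X ⟶ Y) (f : Y ⟶ ballDomainAboveBot.{u}) :
    toFilter (t ≫ f) = (toFilter f).map (inv t) := rfl

/-- The map `midpoint` is the midpoint of the generic pair of projections. Naturality
(`map_midpoint`) specializes it to any pair of generalized points. -/
theorem toSection_lift_midpoint (f g : X ⟶ interval.{u}) :
    toSection (lift f g ≫ midpoint) = (toSection f).midpoint (toSection g) := by
  rw [toSection_comp, midpoint, toSection_homMk, DedekindSection.map_midpoint]
  change (toSection (lift f g ≫ fst _ _)).midpoint (toSection (lift f g ≫ snd _ _)) = _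
  rw [lift_fst, lift_snd]

theorem toFilter_lift_midpointBall (f : X ⟶ interval.{u}) (g : X ⟶ ballDomainAboveBot.{u}) :
    toFilter (lift f g ≫ midpointBall) = (toSection f).midpointBall (toFilter g) := by
  rw [toFilter_comp, midpointBall, toFilter_homMk, DedekindSection.map_midpointBall]
  change (toSection (lift f g ≫ fst _ _)).midpointBall (toFilter (lift f g ≫ snd _ _)) = _
  rw [lift_fst, lift_snd]

theorem toFilter_comp_intervalToBall (f : X ⟶ interval.{u}) :
    toFilter (f ≫ intervalToBall) = (toSection f).toBallFilter := by
  rw [toFilter_comp, intervalToBall, toFilter_homMk, ← DedekindSection.map_toBallFilter]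
  rfl

theorem toFilter_iterationOp (h : X ⟶ interval.{u}) (t : X ⟶ X) (f : X ⟶ ballDomainAboveBot.{u}) :
    toFilter (iterationOp h t f) = (toSection h).iterationStep (inv t) (toFilter f) := by
  rw [iterationOp, ← Category.assoc, lift_whiskerLeft, toFilter_lift_midpointBall, toFilter_comp]
  rfl

theorem toFilter_iterate (h : X ⟶ interval.{u}) (t : X ⟶ X) (n : ℕ) :
    toFilter ((iterationOp h t)^[n] (botBall X)) =
      ((toSection h).iterationStep (inv t))^[n] (BallFilterAboveBot.bot X) := by
  induction n with
  | zero => exact toFilter_homMk _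
  | succ n ih => rw [Function.iterate_succ_apply', Function.iterate_succ_apply',
      toFilter_iterationOp, ih]

theorem eq_lift_midpoint_iff (h : X ⟶ interval.{u}) (t : X ⟶ X) (M : X ⟶ interval.{u}) :
    M = lift h t ≫ (interval ◁ M) ≫ midpoint ↔
      M = homMk ((toSection h).iterationSection (inv t)).toHom := by
  have h₁ : toSection (lift h t ≫ (interval ◁ M) ≫ midpoint) =
      (toSection h).midpoint ((toSection M).map (inv t)) := by
    rw [← Category.assoc, lift_whiskerLeft, toSection_lift_midpoint, toSection_comp]
  have h₂ := (toSection h).eq_midpoint_map_iff (inv t) (toSection M)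
  constructor
  · intro hM
    refine toSection_injective ?_
    rw [toSection_homMk, ← h₂, ← h₁, ← hM]
  · intro hM
    refine toSection_injective ?_
    rw [h₁, ← h₂.2 (by rw [hM, toSection_homMk])]

theorem isMidpointAlgebra_midpoint : IsMidpointAlgebra midpoint.{u} where
  idem x := toSection_injective <| by
    rw [toSection_lift_midpoint, DedekindSection.midpoint_self]
  comm x y := toSection_injective <| by
    rw [toSection_lift_midpoint, toSection_lift_midpoint, DedekindSection.midpoint_comm]
  medial x y z w := toSection_injective <| by
    simp only [toSection_lift_midpoint]
    exact DedekindSection.midpoint_medial _ _ _ _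

theorem isIterative_midpoint : IsIterative midpoint.{u} := fun _ h t =>
  ⟨_, (eq_lift_midpoint_iff h t _).2 rfl, fun M => (eq_lift_midpoint_iff h t M).1⟩

/-- The constant `0` pulls every generator back to `⊤`, so equality only requires that balls of
radius below each `q` cover. -/
theorem comp_radius_eq_zeroRadius {F : X ⟶ ballDomainAboveBot.{u}}
    (hF : ∀ q : ℚ, 0 < q → ⊤ ≤ ⨆ (b : FormalBall) (_ : b.radius < q), (toFilter F).ball b) :
    F ≫ ballInclusion ≫ radius = zeroRadius X := by
  refine hom_ext (Pres.hom_ext fun q => ?_)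
  have h₁ : inv (zeroRadius X) (Pres.gen _ q) = ⊤ := (UpperReal.zero X).toHom_gen q
  have h₂ : inv radius (Pres.gen _ q) =
      ⨆ (b : FormalBall) (_ : b.radius < q.down.1), Pres.gen BallRel (.up b) :=
    UpperReal.toHom_gen _ q
  have h₃ (b : FormalBall) : inv ballInclusion (Pres.gen _ (.up b)) =
      Pres.gen BallRelAboveBot (.up b) := BallFilter.toHom_gen _ (.up b)
  refine Eq.trans (top_le_iff.1 ?_) h₁.symm
  change ⊤ ≤ inv F (inv ballInclusion (inv radius (Pres.gen _ q)))
  rw [h₂]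
  refine (hF q.down.1 q.down.2).trans (iSup₂_le fun b hb => ?_)
  refine (le_of_eq ?_).trans (OrderHomClass.mono (inv F) (OrderHomClass.mono (inv ballInclusion)
    (le_iSup₂_of_le b hb le_rfl)))
  rw [h₃]
  rfl

end Locale

/-! ### Assembly of the theorem -/

theorem mainTheorem2 :
    IsMidpointAlgebra Locale.midpoint.{u} ∧
    IsIterative Locale.midpoint.{u} ∧
    ∀ (X : Locale.{u}) (h : X ⟶ Locale.interval) (t : X ⟶ X),
      ∃ F : X ⟶ Locale.ballDomainAboveBot,
        IsLeast {f | Locale.iterationOp h t f = f} F ∧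
        IsLUB (Set.range fun n : ℕ => (Locale.iterationOp h t)^[n] (Locale.botBall X)) F ∧
        F ≫ Locale.ballInclusion ≫ Locale.radius = Locale.zeroRadius X ∧
        ∃ M : X ⟶ Locale.interval, M ≫ Locale.intervalToBall = F ∧
          M = lift h t ≫ (Locale.interval ◁ M) ≫ Locale.midpoint ∧
          ∀ M' : X ⟶ Locale.interval,
            M' = lift h t ≫ (Locale.interval ◁ M') ≫ Locale.midpoint → M' = M := by
  open Locale in
  refine ⟨isMidpointAlgebra_midpoint, isIterative_midpoint, fun X h t => ?_⟩
  let s := toSection h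
  have hF : toFilter (homMk (s.iterationSup (inv t)).toHom) = s.iterationSup (inv t) :=
    toFilter_homMk _
  refine ⟨homMk (s.iterationSup (inv t)).toHom, ⟨?_, fun f hf => ?_⟩, ⟨?_, fun f hf => ?_⟩, ?_,
    homMk (s.iterationSection (inv t)).toHom, ?_, (eq_lift_midpoint_iff h t _).2 rfl,
    fun M => (eq_lift_midpoint_iff h t M).1⟩
  · refine toFilter_injective ?_
    rw [toFilter_iterationOp, hF, DedekindSection.iterationStep_iterationSup]
  · rw [← toFilter_le_iff, hF]
    refine s.iterationSup_le (inv t) ?_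
    rw [← toFilter_iterationOp, show iterationOp h t f = f from hf]
  · rintro _ ⟨n, rfl⟩
    rw [← toFilter_le_iff, hF, toFilter_iterate]
    exact s.iterate_le_iterationSup (inv t) n
  · rw [← toFilter_le_iff, hF]
    refine (s.isLUB_iterationSup (inv t)).2 ?_
    rintro _ ⟨n, rfl⟩
    dsimp only
    rw [← toFilter_iterate, toFilter_le_iff]
    exact hf ⟨n, rfl⟩
  · refine comp_radius_eq_zeroRadius ?_
    rw [hF]
    exact s.radius_iterationSup (inv t)
  · refine toFilter_injective ?_
    rw [toFilter_comp_intervalToBall, hF, toSection_homMk,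
      DedekindSection.toBallFilter_iterationSection]
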